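/- \textbf{Games.} A scoring game is built recursively, in finitely many steps, as $G=\langle G^{\mathcal L}\mid G^{\mathcal R}\rangle$, where each of $G^{\mathcal L}$, $G^{\mathcal R}$ is either an atom $\emptyset^s$ with $s\in\mathbb R$ (the player has no move; the score is $s$) or a nonempty finite set of scoring games (the options). The followers of $G$ are $G$, its options, the options of these, and so on. An atom in $G$ is an atom of some follower of $G$. $G$ is \emph{guaranteed}, $G\in\mathbb{GS}$, if for every follower $K$ of $G$: if $K=\langle\emptyset^\ell\mid\emptyset^r\rangle$ then $\ell\le r$; if $K=\langle\emptyset^\ell\mid K^{\mathcal R}\rangle$ with $K^{\mathcal R}$ a nonempty set of options, then $\ell\le s$ for every atom $\emptyset^s$ in $K$; if $K=\langle K^{\mathcal L}\mid\emptyset^r\rangle$ with $K^{\mathcal L}$ a nonempty set of options, then $s\le r$ for every atom $\emptyset^s$ in $K$. In the disjunctive sum $G+H$ a player moves in exactly one component; a player with no move in either component gets the sum of the two scores of the atoms. The conjugate $-G$ interchanges Left and Right and negates all atoms; $G-H$ means $G+(-H)$. A real number $s$ denotes $\langle\emptyset^s\mid\emptyset^s\rangle$; $\widehat 0=0$ and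 $\widehat{n+1}=\langle\widehat n\mid\emptyset^0\rangle$. \textbf{Stops and order.} $\mathit{Ls}(G)=\ell$ if $G^{\mathcal L}=\emptyset^\ell$, otherwise $\mathit{Ls}(G)=\max_{G^L}\mathit{Rs}(G^L)$; $\mathit{Rs}(G)=r$ if $G^{\mathcal R}=\emptyset^r$, otherwise $\mathit{Rs}(G)=\min_{G^R}\mathit{Ls}(G^R)$. Put $\underline{\mathit{Ls}}(G)=\min_{n\ge0}\mathit{Ls}(G-\widehat n)$, $\underline{\mathit{Rs}}(G)=\min_{n\ge0}\mathit{Rs}(G-\widehat n)$, $\overline{\mathit{Ls}}(G)=\max_{n\ge0}\mathit{Ls}(G+\widehat n)$, $\overline{\mathit{Rs}}(G)=\max_{n\ge0}\mathit{Rs}(G+\widehat n)$. Write $G\succcurlyeq H$ if $\mathit{Ls}(G+X)\ge\mathit{Ls}(H+X)$ and $\mathit{Rs}(G+X)\ge\mathit{Rs}(H+X)$ for all $X\in\mathbb{GS}$, and $G\sim H$ if $G\succcurlyeq H$ and $H\succcurlyeq G$. \textbf{Reductions.} Left option $A$ of $G$ is reversible through $B$ if $B$ is a Right option of $A$ and $G\succcurlyeq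 B$. The reductions of $G$ on Left's side, which keep $G^{\mathcal R}$, replace $G^{\mathcal L}$ as follows. \begin{enumerate} \item Domination: if $A\ne B$ are Left options and $B\succcurlyeq A$, by $G^{\mathcal L}\setminus\{A\}$. \item Reversibility: if $A$ is reversible through $B$ and $B$ has a Left option, by $(G^{\mathcal L}\setminus\{A\})\cup B^{\mathcal L}$. \item Atomic reversibility: if $A$ is reversible through $B$ and $B^{\mathcal L}=\emptyset^\ell$: (a) if $\underline{\mathit{Ls}}(G)=\underline{\mathit{Rs}}(C)$ for some $C\in G^{\mathcal L}\setminus\{A\}$, by $G^{\mathcal L}\setminus\{A\}$; (b) if $\underline{\mathit{Ls}}(G)=\underline{\mathit{Rs}}(A)>\underline{\mathit{Rs}}(C)$ for all $C\in G^{\mathcal L}\setminus\{A\}$, by $\{\langle\emptyset^\ell\mid B\rangle\}\cup(G^{\mathcal L}\setminus\{A\})$. \item Substitution: if $A$, $B$, $\ell$ are as in 3(b): (a) with $n\ge0$ the smallest integer such that $G\succcurlyeq\ell-\widehat n$, by $\{\ell-\widehat{n+1}\}\cup(G^{\mathcal L}\setminus\{A\})$; (b) if $G^{\mathcal L}=\{A\}$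 and $\langle\emptyset^\ell\mid G^{\mathcal R}\rangle\in\mathbb{GS}$, by $\emptyset^\ell$. \end{enumerate} The reductions on Right's side are the same with the roles of Left and Right interchanged: $\succcurlyeq$ is reversed, $\underline{\mathit{Ls}},\underline{\mathit{Rs}},>,\ell-\widehat n$ become $\overline{\mathit{Rs}},\overline{\mathit{Ls}},<,r+\widehat n$, and so on. A game $G$ is \emph{reduced} if no reduction, on either side, applied to any follower of $G$ (including $G$ itself) yields a game different from that follower. \textbf{Theorem.} Let $G,H\in\mathbb{GS}$. If $G\sim H$ and both $G$ and $H$ are reduced, then $G$ and $H$ are identical: they have the same game tree (options being regarded as sets) with the same atoms in the same positions. -/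

import Mathlib

/-- What one player finds in a position: either an atom `∅^s` (the player has no move and the
score is `s`), or a nonempty finite set of options. -/
inductive Side (α : Type) : Type
  | atom (s : ℝ) : Side α
  | options (S : Set α) (hfin : S.Finite) (hne : S.Nonempty) : Side α

namespace Side

/-- The set of options (empty for an atom). -/
def opts {α : Type} : Side α → Set α
  | atom _ => ∅
  | options S _ _ => S

/-- The side whose options are the members of a nonempty finite family. -/
def ofFamily {α ι : Type} [Finite ι] [Nonempty ι] (f : ι → α) : Side α :=
  options (Set.range f) (Set.finite_range f) (Set.range_nonempty f)

/-- Apply a map to all options, keeping atoms. -/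
def map {α β : Type} (f : α → β) : Side α → Side β
  | atom s => atom s
  | options S hfin hne => options (f '' S) (hfin.image f) (hne.image f)

end Side

/-- The two sides `⟨ 𝓛 ∣ 𝓡 ⟩` of a position, with options taken from `α`. -/
structure TwoSides (α : Type) : Type where
  left : Side α
  right : Side α

instance TwoSides.functor : Functor TwoSides where
  map f x := ⟨x.left.map f, x.right.map f⟩

/-- Index type of the options of a side of shape `a`: none for an atom, `n + 1` for `n`. -/
def SideShape.Index : ℝ ⊕ ℕ → Type
  | Sum.inl _ => Empty
  | Sum.inr n => Fin (n + 1)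

/-- The side presented by a shape and an enumeration of the options. -/
def Side.present {α : Type} : (a : ℝ ⊕ ℕ) → (SideShape.Index a → α) → Side α
  | Sum.inl s, _ => Side.atom s
  | Sum.inr n, f => Side.ofFamily (ι := Fin (n + 1)) f

theorem Side.map_present {α β : Type} (g : α → β) (a : ℝ ⊕ ℕ) (f : SideShape.Index a → α) :
    Side.present a (g ∘ f) = (Side.present a f).map g := by
  cases a with
  | inl s => rfl
  | inr n =>
    have h : Set.range (g ∘ f) = g '' Set.range f := Set.range_comp g f
    simp only [Side.present, Side.ofFamily, Side.map]
    congr 1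

theorem Side.exists_present {α : Type} (s : Side α) :
    ∃ p : (a : ℝ ⊕ ℕ) × (SideShape.Index a → α), Side.present p.1 p.2 = s := by
  cases s with
  | atom s => exact ⟨⟨Sum.inl s, Empty.elim⟩, rfl⟩
  | options S hfin hne =>
    have : Finite S := hfin
    have : Nonempty S := hne.to_subtype
    obtain ⟨n, ⟨e⟩⟩ := Finite.exists_equiv_fin S
    cases n with
    | zero => exact (e (Classical.arbitrary S)).elim0
    | succ n =>
      have hr : Set.range (fun i : Fin (n + 1) => (e.symm i : α)) = S := by
        ext x
        constructor
        · rintro ⟨i, rfl⟩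
          exact (e.symm i).2
        · intro hx
          exact ⟨e ⟨x, hx⟩, by simp⟩
      refine ⟨⟨Sum.inr n, fun i : Fin (n + 1) => (e.symm i : α)⟩, ?_⟩
      simp only [Side.present, Side.ofFamily]
      congr 1

/-- `TwoSides` is a quotient of a polynomial functor, hence has an initial algebra. -/
noncomputable instance TwoSides.qpf : QPF TwoSides where
  P := ⟨(ℝ ⊕ ℕ) × (ℝ ⊕ ℕ), fun a => SideShape.Index a.1 ⊕ SideShape.Index a.2⟩
  abs p := ⟨Side.present p.1.1 (fun i => p.2 (Sum.inl i)),
    Side.present p.1.2 (fun i => p.2 (Sum.inr i))⟩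
  repr x := ⟨(x.left.exists_present.choose.1, x.right.exists_present.choose.1),
    Sum.elim x.left.exists_present.choose.2 x.right.exists_present.choose.2⟩
  abs_repr x := by
    have hl := x.left.exists_present.choose_spec
    have hr := x.right.exists_present.choose_spec
    cases x with
    | mk l r =>
      simp only [Sum.elim_inl, Sum.elim_inr]
      exact congrArg₂ TwoSides.mk hl hr
  abs_map f p := by
    exact congrArg₂ TwoSides.mk (Side.map_present f _ _) (Side.map_present f _ _)

/-- Scoring games `⟨ 𝓛 ∣ 𝓡 ⟩`: the initial algebra of `TwoSides`. Every game is built in finitely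
many steps from atoms and from nonempty finite *sets* of games, and two games are equal exactly
when they are identical: on either side they carry the same atom or the same set of options. -/
def ScoringGame : Type := QPF.Fix TwoSides

namespace ScoringGame

/-- The game `⟨ l ∣ r ⟩`. -/
noncomputable def mk (l r : Side ScoringGame) : ScoringGame :=
  QPF.Fix.mk (F := TwoSides) ⟨l, r⟩

/-- `G^𝓛`. -/
noncomputable def left (G : ScoringGame) : Side ScoringGame := (QPF.Fix.dest (F := TwoSides) G).left

/-- `G^𝓡`. -/
noncomputable def right (G : ScoringGame) : Side ScoringGame :=
  (QPF.Fix.dest (F := TwoSides) G).right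

@[simp] theorem left_mk (l r : Side ScoringGame) : (mk l r).left = l :=
  congrArg TwoSides.left (QPF.Fix.dest_mk (F := TwoSides) ⟨l, r⟩)

@[simp] theorem right_mk (l r : Side ScoringGame) : (mk l r).right = r :=
  congrArg TwoSides.right (QPF.Fix.dest_mk (F := TwoSides) ⟨l, r⟩)

theorem mk_left_right (G : ScoringGame) : mk G.left G.right = G :=
  QPF.Fix.mk_dest (F := TwoSides) G

/-- Equality of games is identity of both sides. -/
theorem ext_sides {G H : ScoringGame} (hl : G.left = H.left) (hr : G.right = H.right) : G = H := by
  rw [← mk_left_right G, ← mk_left_right H, hl, hr]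

/-- `K` is an option (of Left or of Right) of `G`. -/
def IsOption (K G : ScoringGame) : Prop := K ∈ G.left.opts ∨ K ∈ G.right.opts

/-- Induction over the options. -/
theorem induction {p : ScoringGame → Prop}
    (h : ∀ G : ScoringGame, (∀ K : ScoringGame, IsOption K G → p K) → p G) (G : ScoringGame) :
    p G := by
  refine QPF.Fix.ind (F := TwoSides) p ?_ G
  rintro x ⟨u, rfl⟩
  have aux : ∀ (s : Side (Subtype p)) (K : ScoringGame),
      K ∈ (s.map Subtype.val).opts → p K := by
    intro s K hK
    cases s with
    | atom s => exact hK.elim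
    | options S hfin hne =>
      obtain ⟨y, -, rfl⟩ := hK
      exact y.2
  refine h (mk _ _) ?_
  rintro K (hK | hK)
  · have e := left_mk (u.left.map Subtype.val) (u.right.map Subtype.val)
    exact aux u.left K (Eq.mp (congrArg (fun s : Side ScoringGame => K ∈ s.opts) e) hK)
  · have e := right_mk (u.left.map Subtype.val) (u.right.map Subtype.val)
    exact aux u.right K (Eq.mp (congrArg (fun s : Side ScoringGame => K ∈ s.opts) e) hK)

theorem isOption_wf : WellFounded IsOption :=
  ⟨induction fun G ih => Acc.intro G ih⟩

instance : WellFoundedRelation ScoringGame := ⟨IsOption, isOption_wf⟩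

/-- Followers of `G`: `G` itself, its options, their options, and so on. -/
def IsFollower (K G : ScoringGame) : Prop := Relation.ReflTransGen IsOption K G

/-- `∅^s` is an atom in `G`. -/
def IsAtomIn (s : ℝ) (G : ScoringGame) : Prop :=
  ∃ K : ScoringGame, IsFollower K G ∧ (K.left = Side.atom s ∨ K.right = Side.atom s)

/-- Guaranteed games. -/
def Guaranteed (H : ScoringGame) : Prop :=
  ∀ G : ScoringGame, IsFollower G H →
    (∀ l r : ℝ, G.left = Side.atom l → G.right = Side.atom r → l ≤ r) ∧
    (∀ l : ℝ, G.left = Side.atom l → G.right.opts.Nonempty → ∀ s : ℝ, IsAtomIn s G → l ≤ s) ∧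
    (∀ r : ℝ, G.right = Side.atom r → G.left.opts.Nonempty → ∀ s : ℝ, IsAtomIn s G → s ≤ r)

end ScoringGame

namespace Side

/-- One side of a disjunctive sum: if both sides are atoms, the sum of the scores; otherwise the
moves in the first component (family `f`) together with those in the second (family `g`). -/
def combine {α : Type} : (s t : Side α) → (s.opts → α) → (t.opts → α) → Side α
  | atom x, atom y, _, _ => atom (x + y)
  | options S hS nS, t, f, g =>
      have : Finite (options S hS nS).opts := hS
      have : Nonempty (options S hS nS).opts := nS.to_subtype
      have : Finite t.opts := by
        cases t with
        | atom y => exact Set.finite_empty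
        | options T hT nT => exact hT
      ofFamily (Sum.elim f g)
  | atom x, options T hT nT, f, g =>
      have : Finite (atom (α := α) x).opts := Set.finite_empty
      have : Finite (options T hT nT).opts := hT
      have : Nonempty (options T hT nT).opts := nT.to_subtype
      ofFamily (Sum.elim f g)

/-- One side of a conjugate: atoms change sign, and each option is replaced by its image. -/
def conjugate {α : Type} : (s : Side α) → (s.opts → α) → Side α
  | atom x, _ => atom (-x)
  | options S hS nS, f =>
      have : Finite (options S hS nS).opts := hS
      have : Nonempty (options S hS nS).opts := nS.to_subtype
      ofFamily f

/-- The score of a side: the score of the atom, or `agg` (maximum or minimum) of the values of the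
options. -/
def score {α : Type} (agg : Set ℝ → ℝ) : (s : Side α) → (s.opts → ℝ) → ℝ
  | atom x, _ => x
  | options _ _ _, v => agg (Set.range v)

end Side

namespace ScoringGame

/-- Disjunctive sum. -/
noncomputable def add (G H : ScoringGame) : ScoringGame :=
  mk (Side.combine G.left H.left (fun X => add X.1 H) (fun Y => add G Y.1))
    (Side.combine G.right H.right (fun X => add X.1 H) (fun Y => add G Y.1))
termination_by (G, H)
decreasing_by
  · exact Prod.Lex.left _ _ (Or.inl X.2)
  · exact Prod.Lex.right _ (Or.inl Y.2)
  · exact Prod.Lex.left _ _ (Or.inr X.2)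
  · exact Prod.Lex.right _ (Or.inr Y.2)

noncomputable instance : Add ScoringGame := ⟨add⟩

/-- The conjugate, written `-G`: the roles of Left and Right are interchanged. -/
noncomputable def conj (G : ScoringGame) : ScoringGame :=
  mk (Side.conjugate G.right (fun X => conj X.1)) (Side.conjugate G.left (fun X => conj X.1))
termination_by G
decreasing_by
  · exact Or.inr X.2
  · exact Or.inl X.2

/-- The number `s = ⟨ ∅^s ∣ ∅^s ⟩`. -/
noncomputable def number (s : ℝ) : ScoringGame := mk (Side.atom s) (Side.atom s)

/-- The waiting move `n̂`: `0̂ = ⟨ ∅^0 ∣ ∅^0 ⟩` and the game after it is `⟨ n̂ ∣ ∅^0 ⟩`. -/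
noncomputable def waiting : ℕ → ScoringGame
  | 0 => number 0
  | n + 1 => mk (Side.ofFamily (fun _ : Unit => waiting n)) (Side.atom 0)

/- Left-stop and Right-stop. The sets under `sSup` and `sInf` are nonempty and finite, so these are
the maximum and the minimum. -/
mutual

noncomputable def Ls (G : ScoringGame) : ℝ := G.left.score sSup (fun X => Rs X.1)
termination_by G
decreasing_by exact Or.inl X.2

noncomputable def Rs (G : ScoringGame) : ℝ := G.right.score sInf (fun X => Ls X.1)
termination_by G
decreasing_by exact Or.inr X.2

end

/- Pass-allowed stops. For fixed `G` the stops involved take finitely many values (all of them are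
atoms in `G`), so the infima and suprema are minima and maxima. Underline: Right can pass;
overline: Left can pass. -/

noncomputable def underLs (G : ScoringGame) : ℝ := ⨅ n : ℕ, Ls (G + conj (waiting n))

noncomputable def underRs (G : ScoringGame) : ℝ := ⨅ n : ℕ, Rs (G + conj (waiting n))

noncomputable def overLs (G : ScoringGame) : ℝ := ⨆ n : ℕ, Ls (G + waiting n)

noncomputable def overRs (G : ScoringGame) : ℝ := ⨆ n : ℕ, Rs (G + waiting n)

/-- `G ≽ H`. -/
def Ge (G H : ScoringGame) : Prop :=
  ∀ X : ScoringGame, Guaranteed X → Ls (G + X) ≥ Ls (H + X) ∧ Rs (G + X) ≥ Rs (H + X)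

/-- `G ∼ H`. -/
def Equivalent (G H : ScoringGame) : Prop := Ge G H ∧ Ge H G

/-- The Left option `A` of `G` is reversible through `B`. -/
def LeftReversible (G A B : ScoringGame) : Prop :=
  A ∈ G.left.opts ∧ B ∈ A.right.opts ∧ Ge G B

/-- The Right option `A` of `G` is reversible through `B`. -/
def RightReversible (G A B : ScoringGame) : Prop :=
  A ∈ G.right.opts ∧ B ∈ A.left.opts ∧ Ge B G

/-- `H` results from `G` by one application of a reduction to the Left options. -/
inductive LeftReduction : ScoringGame → ScoringGame → Prop
  /-- Erase a dominated option. -/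
  | domination {G H A B : ScoringGame} (hA : A ∈ G.left.opts) (hB : B ∈ G.left.opts)
      (hAB : A ≠ B) (hdom : Ge B A)
      (hl : H.left.opts = G.left.opts \ {A}) (hr : H.right = G.right) : LeftReduction G H
  /-- Bypass a non-atomic-reversible option. -/
  | reversibility {G H A B : ScoringGame} (hrev : LeftReversible G A B)
      (hB : B.left.opts.Nonempty)
      (hl : H.left.opts = (G.left.opts \ {A}) ∪ B.left.opts) (hr : H.right = G.right) :
      LeftReduction G H
  /-- Erase an atomic-reversible option when another option attains the pass-allowed stop. -/
  | atomicErase {G H A B C : ScoringGame} {l : ℝ} (hrev : LeftReversible G A B)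
      (hB : B.left = Side.atom l) (hC : C ∈ G.left.opts \ {A}) (hbest : underLs G = underRs C)
      (hl : H.left.opts = G.left.opts \ {A}) (hr : H.right = G.right) : LeftReduction G H
  /-- Replace an atomic-reversible option by `⟨ ∅^l ∣ B ⟩`. -/
  | atomicReplace {G H A B : ScoringGame} {l : ℝ} (hrev : LeftReversible G A B)
      (hB : B.left = Side.atom l) (hA : underLs G = underRs A)
      (hother : ∀ C ∈ G.left.opts \ {A}, underRs C < underRs A)
      (hl : H.left.opts =
        {mk (Side.atom l) (Side.ofFamily (fun _ : Unit => B))} ∪ (G.left.opts \ {A}))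
      (hr : H.right = G.right) : LeftReduction G H
  /-- Substitute the number `l` minus `n + 1` waiting moves for an atomic-reversible option. -/
  | substituteWaiting {G H A B : ScoringGame} {l : ℝ} {n : ℕ} (hrev : LeftReversible G A B)
      (hB : B.left = Side.atom l) (hA : underLs G = underRs A)
      (hother : ∀ C ∈ G.left.opts \ {A}, underRs C < underRs A)
      (hn : IsLeast {k : ℕ | Ge G (number l + conj (waiting k))} n)
      (hl : H.left.opts = {number l + conj (waiting (n + 1))} ∪ (G.left.opts \ {A}))
      (hr : H.right = G.right) : LeftReduction G H
  /-- Substitute the atom `∅^l` for an atomic-reversible option that is the only one. -/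
  | substituteAtom {G H A B : ScoringGame} {l : ℝ} (hrev : LeftReversible G A B)
      (hB : B.left = Side.atom l) (hA : underLs G = underRs A)
      (honly : G.left.opts = {A}) (hgs : Guaranteed (mk (Side.atom l) G.right))
      (hl : H.left = Side.atom l) (hr : H.right = G.right) : LeftReduction G H

/-- `H` results from `G` by one application of a reduction to the Right options. -/
inductive RightReduction : ScoringGame → ScoringGame → Prop
  /-- Erase a dominated option. -/
  | domination {G H A B : ScoringGame} (hA : A ∈ G.right.opts) (hB : B ∈ G.right.opts)
      (hAB : A ≠ B) (hdom : Ge A B)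
      (hr : H.right.opts = G.right.opts \ {A}) (hl : H.left = G.left) : RightReduction G H
  /-- Bypass a non-atomic-reversible option. -/
  | reversibility {G H A B : ScoringGame} (hrev : RightReversible G A B)
      (hB : B.right.opts.Nonempty)
      (hr : H.right.opts = (G.right.opts \ {A}) ∪ B.right.opts) (hl : H.left = G.left) :
      RightReduction G H
  /-- Erase an atomic-reversible option when another option attains the pass-allowed stop. -/
  | atomicErase {G H A B C : ScoringGame} {r : ℝ} (hrev : RightReversible G A B)
      (hB : B.right = Side.atom r) (hC : C ∈ G.right.opts \ {A}) (hbest : overRs G = overLs C)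
      (hr : H.right.opts = G.right.opts \ {A}) (hl : H.left = G.left) : RightReduction G H
  /-- Replace an atomic-reversible option by `⟨ B ∣ ∅^r ⟩`. -/
  | atomicReplace {G H A B : ScoringGame} {r : ℝ} (hrev : RightReversible G A B)
      (hB : B.right = Side.atom r) (hA : overRs G = overLs A)
      (hother : ∀ C ∈ G.right.opts \ {A}, overLs A < overLs C)
      (hr : H.right.opts =
        {mk (Side.ofFamily (fun _ : Unit => B)) (Side.atom r)} ∪ (G.right.opts \ {A}))
      (hl : H.left = G.left) : RightReduction G H
  /-- Substitute the number `r` plus `n + 1` waiting moves for an atomic-reversible option. -/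
  | substituteWaiting {G H A B : ScoringGame} {r : ℝ} {n : ℕ} (hrev : RightReversible G A B)
      (hB : B.right = Side.atom r) (hA : overRs G = overLs A)
      (hother : ∀ C ∈ G.right.opts \ {A}, overLs A < overLs C)
      (hn : IsLeast {k : ℕ | Ge (number r + waiting k) G} n)
      (hr : H.right.opts = {number r + waiting (n + 1)} ∪ (G.right.opts \ {A}))
      (hl : H.left = G.left) : RightReduction G H
  /-- Substitute the atom `∅^r` for an atomic-reversible option that is the only one. -/
  | substituteAtom {G H A B : ScoringGame} {r : ℝ} (hrev : RightReversible G A B)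
      (hB : B.right = Side.atom r) (hA : overRs G = overLs A)
      (honly : G.right.opts = {A}) (hgs : Guaranteed (mk G.left (Side.atom r)))
      (hr : H.right = Side.atom r) (hl : H.left = G.left) : RightReduction G H

/-- `G` is reduced: no reduction applied to a follower of `G` (`G` included) changes it. -/
def Reduced (G : ScoringGame) : Prop :=
  ∀ K : ScoringGame, IsFollower K G → ∀ H : ScoringGame,
    LeftReduction K H ∨ RightReduction K H → H = K

end ScoringGame

/-!
Induct on `G`. Equivalent games answer each other's moves (`Ge.left_maintenance`): if `G ≽ H`, then
every Left option `A` of `H` has a Left option of `G` above it or a Right reply that is below `G`.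
This holds because games without such an answer are separated by a test game assembled from the
test games for the finitely many options (`exists_downlink`).

In a reduced game `G` the Left options are of two kinds. Since `underLs G` is the largest
`underRs A` over the Left options `A` (`exists_underLs_eq`), one of the reductions of an
atomic-reversible option always applies. Hence at most one Left option is reversible;
it has the form `ℓ - (n + 1)^`, where `ℓ = underLs G` and `n` is the least number with
`G ≽ ℓ - n̂`, and `underRs` is smaller than `ℓ` on all other options
(`LeftReduced.reversible_option`). Such an `n` exists because a game all of whose atoms are at least
`ℓ` is `≽ ℓ - n̂` for large `n` (`exists_forall_ge_number_add_conj_waiting`).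

Let `G ∼ H` be reduced. A Left option of `G` that is not reversible is, by maintenance and the lack
of dominated options, equivalent to a Left option of `H`, hence equal to it by induction. A
reversible one is determined by `ℓ` and `n`, which depend only on the equivalence class. So
`G.left = H.left`, unless one of the two games has the single Left option `ℓ - (n + 1)^` and the
other the Left atom `∅^ℓ` (`left_eq_or_exceptional`). Conjugation gives the same on the Right side.
In the exceptional case the single option could have been replaced by the atom `∅^ℓ`: the result
would be guaranteed, because the Right sides are equal or carry the same single score.
-/

/-! ### Sides -/

namespace Side

variable {α : Type}

theorem exists_atom_or_nonempty (s : Side α) : (∃ x, s = atom x) ∨ s.opts.Nonempty := by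
  cases s with
  | atom x => exact Or.inl ⟨x, rfl⟩
  | options S hS nS => exact Or.inr nS

theorem finite_opts (s : Side α) : s.opts.Finite := by
  cases s with
  | atom x => exact Set.finite_empty
  | options S hS nS => exact hS

theorem opts_of_eq_atom {s : Side α} {x : ℝ} (h : s = atom x) : s.opts = ∅ := by
  subst h; rfl

theorem not_mem_opts_of_eq_atom {s : Side α} {x : ℝ} (h : s = atom x) {a : α} : a ∉ s.opts := by
  simp [opts_of_eq_atom h]

/-- A side that has options is determined by them. -/
theorem eq_of_opts_eq {s t : Side α} (h : s.opts = t.opts) (hs : s.opts.Nonempty) : s = t := by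
  cases s with
  | atom x => exact absurd hs Set.not_nonempty_empty
  | options S hS nS =>
    cases t with
    | atom y => exact absurd (h ▸ hs) Set.not_nonempty_empty
    | options T hT nT =>
      have h' : S = T := h
      subst h'; rfl

theorem opts_ofFamily {ι : Type} [Finite ι] [Nonempty ι] (f : ι → α) :
    (ofFamily f).opts = Set.range f := rfl

theorem opts_combine (s t : Side α) (f : s.opts → α) (g : t.opts → α) :
    (combine s t f g).opts = Set.range f ∪ Set.range g := by
  cases s with
  | atom x =>
    cases t with
    | atom y =>
      ext z
      simp only [Set.mem_union, Set.mem_range]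
      constructor
      · exact fun h => h.elim
      · rintro (⟨⟨_, h⟩, _⟩ | ⟨⟨_, h⟩, _⟩) <;> exact h.elim
    | options T hT nT => exact Set.Sum.elim_range f g
  | options S hS nS => exact Set.Sum.elim_range f g

theorem combine_of_eq_atom {s t : Side α} {x y : ℝ} (hs : s = atom x) (ht : t = atom y)
    (f : s.opts → α) (g : t.opts → α) : combine s t f g = atom (x + y) := by
  subst hs ht; rfl

theorem opts_conjugate (s : Side α) (f : s.opts → α) : (conjugate s f).opts = Set.range f := by
  cases s with
  | atom x =>
    ext z
    constructor
    · exact fun h => h.elim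
    · rintro ⟨⟨_, h⟩, _⟩; exact h.elim
  | options S hS nS => rfl

theorem conjugate_of_eq_atom {s : Side α} {x : ℝ} (hs : s = atom x) (f : s.opts → α) :
    conjugate s f = atom (-x) := by
  subst hs; rfl

theorem score_of_eq_atom {s : Side α} {x : ℝ} (hs : s = atom x) (agg : Set ℝ → ℝ)
    (v : s.opts → ℝ) : score agg s v = x := by
  subst hs; rfl

theorem score_of_nonempty {s : Side α} (hs : s.opts.Nonempty) (agg : Set ℝ → ℝ)
    (v : s.opts → ℝ) : score agg s v = agg (Set.range v) := by
  cases s with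
  | atom x => exact absurd hs Set.not_nonempty_empty
  | options S hS nS => rfl

end Side

namespace ScoringGame

/-! ### Sides of sums, conjugates, numbers and waiting moves -/

theorem left_opts_add (G H : ScoringGame) :
    (G + H).left.opts = (fun X => X + H) '' G.left.opts ∪ (fun Y => G + Y) '' H.left.opts := by
  change (add G H).left.opts = _
  rw [add, left_mk, Side.opts_combine, Set.image_eq_range, Set.image_eq_range]
  rfl

theorem right_opts_add (G H : ScoringGame) :
    (G + H).right.opts = (fun X => X + H) '' G.right.opts ∪ (fun Y => G + Y) '' H.right.opts := by
  change (add G H).right.opts = _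
  rw [add, right_mk, Side.opts_combine, Set.image_eq_range, Set.image_eq_range]
  rfl

theorem left_add_eq_atom {G H : ScoringGame} {x y : ℝ} (hG : G.left = Side.atom x)
    (hH : H.left = Side.atom y) : (G + H).left = Side.atom (x + y) := by
  change (add G H).left = _
  rw [add, left_mk, Side.combine_of_eq_atom hG hH]

theorem right_add_eq_atom {G H : ScoringGame} {x y : ℝ} (hG : G.right = Side.atom x)
    (hH : H.right = Side.atom y) : (G + H).right = Side.atom (x + y) := by
  change (add G H).right = _
  rw [add, right_mk, Side.combine_of_eq_atom hG hH]

theorem add_mem_left_opts_of_left {G H A : ScoringGame} (hA : A ∈ G.left.opts) :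
    A + H ∈ (G + H).left.opts := by
  rw [left_opts_add]; exact Or.inl ⟨A, hA, rfl⟩

theorem add_mem_left_opts_of_right {G H A : ScoringGame} (hA : A ∈ H.left.opts) :
    G + A ∈ (G + H).left.opts := by
  rw [left_opts_add]; exact Or.inr ⟨A, hA, rfl⟩

theorem add_mem_right_opts_of_left {G H A : ScoringGame} (hA : A ∈ G.right.opts) :
    A + H ∈ (G + H).right.opts := by
  rw [right_opts_add]; exact Or.inl ⟨A, hA, rfl⟩

theorem add_mem_right_opts_of_right {G H A : ScoringGame} (hA : A ∈ H.right.opts) :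
    G + A ∈ (G + H).right.opts := by
  rw [right_opts_add]; exact Or.inr ⟨A, hA, rfl⟩

theorem left_opts_conj (G : ScoringGame) : (conj G).left.opts = conj '' G.right.opts := by
  rw [conj, left_mk, Side.opts_conjugate, Set.image_eq_range]

theorem right_opts_conj (G : ScoringGame) : (conj G).right.opts = conj '' G.left.opts := by
  rw [conj, right_mk, Side.opts_conjugate, Set.image_eq_range]

theorem left_conj_eq_atom {G : ScoringGame} {x : ℝ} (h : G.right = Side.atom x) :
    (conj G).left = Side.atom (-x) := by
  rw [conj, left_mk, Side.conjugate_of_eq_atom h]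

theorem right_conj_eq_atom {G : ScoringGame} {x : ℝ} (h : G.left = Side.atom x) :
    (conj G).right = Side.atom (-x) := by
  rw [conj, right_mk, Side.conjugate_of_eq_atom h]

theorem conj_conj (G : ScoringGame) : conj (conj G) = G := by
  induction G using ScoringGame.induction with
  | h G ih =>
    apply ext_sides
    · rcases G.left.exists_atom_or_nonempty with ⟨x, hx⟩ | hne
      · rw [left_conj_eq_atom (right_conj_eq_atom hx), neg_neg, hx]
      · have e : (conj (conj G)).left.opts = G.left.opts := by
          rw [left_opts_conj, right_opts_conj, Set.image_image]
          exact (Set.image_congr fun K hK => ih K (Or.inl hK)).trans (Set.image_id' _)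
        exact Side.eq_of_opts_eq e (e ▸ hne)
    · rcases G.right.exists_atom_or_nonempty with ⟨x, hx⟩ | hne
      · rw [right_conj_eq_atom (left_conj_eq_atom hx), neg_neg, hx]
      · have e : (conj (conj G)).right.opts = G.right.opts := by
          rw [right_opts_conj, left_opts_conj, Set.image_image]
          exact (Set.image_congr fun K hK => ih K (Or.inr hK)).trans (Set.image_id' _)
        exact Side.eq_of_opts_eq e (e ▸ hne)

theorem conj_injective : Function.Injective conj := fun G H h => by
  rw [← conj_conj G, h, conj_conj]

theorem conj_mem_left_opts_conj {A G : ScoringGame} :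
    conj A ∈ (conj G).left.opts ↔ A ∈ G.right.opts := by
  rw [left_opts_conj, conj_injective.mem_set_image]

theorem conj_mem_right_opts_conj {A G : ScoringGame} :
    conj A ∈ (conj G).right.opts ↔ A ∈ G.left.opts := by
  rw [right_opts_conj, conj_injective.mem_set_image]

theorem conj_add (G H : ScoringGame) : conj (G + H) = conj G + conj H := by
  induction G using ScoringGame.induction generalizing H with
  | h G ihG =>
  induction H using ScoringGame.induction with
  | h H ihH =>
    have eL : (conj (G + H)).left.opts = (conj G + conj H).left.opts := by
      simp only [left_opts_conj, right_opts_add, left_opts_add, Set.image_union, Set.image_image]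
      exact congrArg₂ _ (Set.image_congr fun K hK => ihG K (Or.inr hK) H)
        (Set.image_congr fun K hK => ihH K (Or.inr hK))
    have eR : (conj (G + H)).right.opts = (conj G + conj H).right.opts := by
      simp only [right_opts_conj, right_opts_add, left_opts_add, Set.image_union, Set.image_image]
      exact congrArg₂ _ (Set.image_congr fun K hK => ihG K (Or.inl hK) H)
        (Set.image_congr fun K hK => ihH K (Or.inl hK))
    apply ext_sides
    · by_cases hne : (conj (G + H)).left.opts.Nonempty
      · exact Side.eq_of_opts_eq eL hne
      · rw [left_opts_conj, right_opts_add, Set.image_nonempty, Set.union_nonempty,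
          Set.image_nonempty, Set.image_nonempty, not_or] at hne
        obtain ⟨x, hx⟩ := G.right.exists_atom_or_nonempty.resolve_right hne.1
        obtain ⟨y, hy⟩ := H.right.exists_atom_or_nonempty.resolve_right hne.2
        rw [left_conj_eq_atom (right_add_eq_atom hx hy),
          left_add_eq_atom (left_conj_eq_atom hx) (left_conj_eq_atom hy), neg_add]
    · by_cases hne : (conj (G + H)).right.opts.Nonempty
      · exact Side.eq_of_opts_eq eR hne
      · rw [right_opts_conj, left_opts_add, Set.image_nonempty, Set.union_nonempty,
          Set.image_nonempty, Set.image_nonempty, not_or] at hne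
        obtain ⟨x, hx⟩ := G.left.exists_atom_or_nonempty.resolve_right hne.1
        obtain ⟨y, hy⟩ := H.left.exists_atom_or_nonempty.resolve_right hne.2
        rw [right_conj_eq_atom (left_add_eq_atom hx hy),
          right_add_eq_atom (right_conj_eq_atom hx) (right_conj_eq_atom hy), neg_add]

protected theorem add_assoc (G H K : ScoringGame) : G + H + K = G + (H + K) := by
  induction G using ScoringGame.induction generalizing H K with
  | h G ihG =>
  induction H using ScoringGame.induction generalizing K with
  | h H ihH =>
  induction K using ScoringGame.induction with
  | h K ihK =>
    have eL : (G + H + K).left.opts = (G + (H + K)).left.opts := by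
      simp only [left_opts_add, Set.image_union, Set.image_image, Set.union_assoc]
      exact congrArg₂ _ (Set.image_congr fun A hA => ihG A (Or.inl hA) H K) <| congrArg₂ _
        (Set.image_congr fun A hA => ihH A (Or.inl hA) K)
        (Set.image_congr fun A hA => ihK A (Or.inl hA))
    have eR : (G + H + K).right.opts = (G + (H + K)).right.opts := by
      simp only [right_opts_add, Set.image_union, Set.image_image, Set.union_assoc]
      exact congrArg₂ _ (Set.image_congr fun A hA => ihG A (Or.inr hA) H K) <| congrArg₂ _
        (Set.image_congr fun A hA => ihH A (Or.inr hA) K)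
        (Set.image_congr fun A hA => ihK A (Or.inr hA))
    apply ext_sides
    · by_cases hne : (G + H + K).left.opts.Nonempty
      · exact Side.eq_of_opts_eq eL hne
      · simp only [left_opts_add, Set.image_nonempty, Set.union_nonempty, not_or] at hne
        obtain ⟨x, hx⟩ := G.left.exists_atom_or_nonempty.resolve_right hne.1.1
        obtain ⟨y, hy⟩ := H.left.exists_atom_or_nonempty.resolve_right hne.1.2
        obtain ⟨z, hz⟩ := K.left.exists_atom_or_nonempty.resolve_right hne.2
        rw [left_add_eq_atom (left_add_eq_atom hx hy) hz,
          left_add_eq_atom hx (left_add_eq_atom hy hz), _root_.add_assoc]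
    · by_cases hne : (G + H + K).right.opts.Nonempty
      · exact Side.eq_of_opts_eq eR hne
      · simp only [right_opts_add, Set.image_nonempty, Set.union_nonempty, not_or] at hne
        obtain ⟨x, hx⟩ := G.right.exists_atom_or_nonempty.resolve_right hne.1.1
        obtain ⟨y, hy⟩ := H.right.exists_atom_or_nonempty.resolve_right hne.1.2
        obtain ⟨z, hz⟩ := K.right.exists_atom_or_nonempty.resolve_right hne.2
        rw [right_add_eq_atom (right_add_eq_atom hx hy) hz,
          right_add_eq_atom hx (right_add_eq_atom hy hz), _root_.add_assoc]

theorem left_number (s : ℝ) : (number s).left = Side.atom s := left_mk _ _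

theorem right_number (s : ℝ) : (number s).right = Side.atom s := right_mk _ _

theorem conj_number (s : ℝ) : conj (number s) = number (-s) :=
  ext_sides ((left_conj_eq_atom (right_number s)).trans (left_number _).symm)
    ((right_conj_eq_atom (left_number s)).trans (right_number _).symm)

theorem right_waiting (n : ℕ) : (waiting n).right = Side.atom 0 := by
  cases n <;> simp [waiting, number]

theorem left_opts_waiting_succ (n : ℕ) : (waiting (n + 1)).left.opts = {waiting n} := by
  rw [waiting, left_mk, Side.opts_ofFamily, Set.range_const]

theorem left_conj_waiting (n : ℕ) : (conj (waiting n)).left = Side.atom 0 := by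
  rw [left_conj_eq_atom (right_waiting n), neg_zero]

theorem conj_waiting_zero : conj (waiting 0) = number 0 := by
  rw [waiting, conj_number, neg_zero]

theorem right_opts_conj_waiting_succ (n : ℕ) :
    (conj (waiting (n + 1))).right.opts = {conj (waiting n)} := by
  rw [right_opts_conj, left_opts_waiting_succ, Set.image_singleton]

theorem left_number_add_conj_waiting (l : ℝ) (n : ℕ) :
    (number l + conj (waiting n)).left = Side.atom l := by
  rw [left_add_eq_atom (left_number l) (left_conj_waiting n), add_zero]

theorem right_opts_number_add_conj_waiting_succ (l : ℝ) (n : ℕ) :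
    (number l + conj (waiting (n + 1))).right.opts = {number l + conj (waiting n)} := by
  rw [right_opts_add, right_opts_conj_waiting_succ, Side.opts_of_eq_atom (right_number l),
    Set.image_empty, Set.empty_union, Set.image_singleton]

/-! ### Stops -/

theorem Ls_of_atom {G : ScoringGame} {x : ℝ} (h : G.left = Side.atom x) : Ls G = x := by
  rw [Ls, Side.score_of_eq_atom h]

theorem Rs_of_atom {G : ScoringGame} {x : ℝ} (h : G.right = Side.atom x) : Rs G = x := by
  rw [Rs, Side.score_of_eq_atom h]

theorem Ls_eq_sSup {G : ScoringGame} (h : G.left.opts.Nonempty) :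
    Ls G = sSup (Rs '' G.left.opts) := by
  rw [Ls, Side.score_of_nonempty h, Set.image_eq_range]

theorem Rs_eq_sInf {G : ScoringGame} (h : G.right.opts.Nonempty) :
    Rs G = sInf (Ls '' G.right.opts) := by
  rw [Rs, Side.score_of_nonempty h, Set.image_eq_range]

theorem Rs_le_Ls_of_mem_left {G A : ScoringGame} (hA : A ∈ G.left.opts) : Rs A ≤ Ls G := by
  rw [Ls_eq_sSup ⟨A, hA⟩]
  exact le_csSup (G.left.finite_opts.image _).bddAbove ⟨A, hA, rfl⟩

theorem Rs_le_Ls_of_mem_right {G A : ScoringGame} (hA : A ∈ G.right.opts) : Rs G ≤ Ls A := by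
  rw [Rs_eq_sInf ⟨A, hA⟩]
  exact csInf_le (G.right.finite_opts.image _).bddBelow ⟨A, hA, rfl⟩

theorem exists_Ls_eq {G : ScoringGame} (h : G.left.opts.Nonempty) :
    ∃ A ∈ G.left.opts, Ls G = Rs A := by
  rw [Ls_eq_sSup h]
  obtain ⟨A, hA, e⟩ := (h.image Rs).csSup_mem (G.left.finite_opts.image _)
  exact ⟨A, hA, e.symm⟩

theorem exists_Rs_eq {G : ScoringGame} (h : G.right.opts.Nonempty) :
    ∃ A ∈ G.right.opts, Rs G = Ls A := by
  rw [Rs_eq_sInf h]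
  obtain ⟨A, hA, e⟩ := (h.image Ls).csInf_mem (G.right.finite_opts.image _)
  exact ⟨A, hA, e.symm⟩

theorem stops_conj (G : ScoringGame) : Ls (conj G) = -Rs G ∧ Rs (conj G) = -Ls G := by
  induction G using ScoringGame.induction with
  | h G ih =>
    constructor
    · rcases G.right.exists_atom_or_nonempty with ⟨x, hx⟩ | hne
      · rw [Ls_of_atom (left_conj_eq_atom hx), Rs_of_atom hx]
      · rw [Rs_eq_sInf hne, Ls_eq_sSup (by rw [left_opts_conj]; exact hne.image _), left_opts_conj,
          Set.image_image, Set.image_congr fun K hK => (ih K (Or.inr hK)).2, ← Real.sSup_neg,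
          ← Set.image_neg_eq_neg, Set.image_image]
    · rcases G.left.exists_atom_or_nonempty with ⟨x, hx⟩ | hne
      · rw [Rs_of_atom (right_conj_eq_atom hx), Ls_of_atom hx]
      · rw [Ls_eq_sSup hne, Rs_eq_sInf (by rw [right_opts_conj]; exact hne.image _),
          right_opts_conj, Set.image_image, Set.image_congr fun K hK => (ih K (Or.inl hK)).1,
          ← Real.sInf_neg, ← Set.image_neg_eq_neg, Set.image_image]

theorem stops_add_number (G : ScoringGame) (s : ℝ) :
    Ls (G + number s) = Ls G + s ∧ Rs (G + number s) = Rs G + s := by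
  induction G using ScoringGame.induction with
  | h G ih =>
    have eL : (G + number s).left.opts = (fun X => X + number s) '' G.left.opts := by
      rw [left_opts_add, Side.opts_of_eq_atom (left_number s), Set.image_empty, Set.union_empty]
    have eR : (G + number s).right.opts = (fun X => X + number s) '' G.right.opts := by
      rw [right_opts_add, Side.opts_of_eq_atom (right_number s), Set.image_empty, Set.union_empty]
    constructor
    · rcases G.left.exists_atom_or_nonempty with ⟨x, hx⟩ | hne
      · rw [Ls_of_atom (left_add_eq_atom hx (left_number s)), Ls_of_atom hx]
      · apply le_antisymm
        · obtain ⟨A, hA, e⟩ := exists_Ls_eq (G := G + number s) (eL ▸ hne.image _)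
          rw [eL] at hA
          obtain ⟨B, hB, rfl⟩ := hA
          rw [e, (ih B (Or.inl hB)).2]
          exact add_le_add_left (Rs_le_Ls_of_mem_left hB) s
        · obtain ⟨A, hA, e⟩ := exists_Ls_eq hne
          rw [e, ← (ih A (Or.inl hA)).2]
          exact Rs_le_Ls_of_mem_left (add_mem_left_opts_of_left hA)
    · rcases G.right.exists_atom_or_nonempty with ⟨x, hx⟩ | hne
      · rw [Rs_of_atom (right_add_eq_atom hx (right_number s)), Rs_of_atom hx]
      · apply le_antisymm
        · obtain ⟨A, hA, e⟩ := exists_Rs_eq hne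
          rw [e, ← (ih A (Or.inr hA)).1]
          exact Rs_le_Ls_of_mem_right (add_mem_right_opts_of_left hA)
        · obtain ⟨A, hA, e⟩ := exists_Rs_eq (G := G + number s) (eR ▸ hne.image _)
          rw [eR] at hA
          obtain ⟨B, hB, rfl⟩ := hA
          rw [e, (ih B (Or.inr hB)).1]
          exact add_le_add_left (Rs_le_Ls_of_mem_right hB) s

theorem Ls_add_number (G : ScoringGame) (s : ℝ) : Ls (G + number s) = Ls G + s :=
  (stops_add_number G s).1

theorem Rs_add_number (G : ScoringGame) (s : ℝ) : Rs (G + number s) = Rs G + s :=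
  (stops_add_number G s).2

/-! ### Followers, atoms and guaranteed games -/

theorem isFollower_iff {K G : ScoringGame} :
    IsFollower K G ↔ K = G ∨ ∃ O, IsOption O G ∧ IsFollower K O := by
  unfold IsFollower
  rw [Relation.ReflTransGen.cases_tail_iff]
  exact or_congr eq_comm (exists_congr fun _ => and_comm)

theorem isAtomIn_iff {s : ℝ} {G : ScoringGame} :
    IsAtomIn s G ↔ G.left = Side.atom s ∨ G.right = Side.atom s ∨
      ∃ O, IsOption O G ∧ IsAtomIn s O := by
  constructor
  · rintro ⟨K, hK, h⟩
    rcases isFollower_iff.1 hK with rfl | ⟨O, hO, hKO⟩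
    · exact h.imp_right Or.inl
    · exact Or.inr (Or.inr ⟨O, hO, K, hKO, h⟩)
  · rintro (h | h | ⟨O, hO, K, hK, h⟩)
    · exact ⟨G, Relation.ReflTransGen.refl, Or.inl h⟩
    · exact ⟨G, Relation.ReflTransGen.refl, Or.inr h⟩
    · exact ⟨K, hK.tail hO, h⟩

theorem IsAtomIn.of_isOption {s : ℝ} {G O : ScoringGame} (hs : IsAtomIn s O) (hO : IsOption O G) :
    IsAtomIn s G :=
  isAtomIn_iff.2 (Or.inr (Or.inr ⟨O, hO, hs⟩))

/-- A recursive form of `Guaranteed` in which the case of two atoms needs no separate clause. -/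
theorem guaranteed_iff {G : ScoringGame} :
    Guaranteed G ↔ (∀ O, IsOption O G → Guaranteed O) ∧
      (∀ l, G.left = Side.atom l → ∀ s, IsAtomIn s G → l ≤ s) ∧
      (∀ r, G.right = Side.atom r → ∀ s, IsAtomIn s G → s ≤ r) := by
  constructor
  · intro h
    obtain ⟨h1, h2, h3⟩ := h G Relation.ReflTransGen.refl
    refine ⟨fun O hO K hK => h K (hK.tail hO), fun l hl s hs => ?_, fun r hr s hs => ?_⟩
    · rcases G.right.exists_atom_or_nonempty with ⟨r, hr⟩ | hne
      · rcases isAtomIn_iff.1 hs with h | h | ⟨O, hO | hO, -⟩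
        · rw [hl] at h; injection h with h; exact h.le
        · exact h1 l s hl h
        · exact (Side.not_mem_opts_of_eq_atom hl hO).elim
        · exact (Side.not_mem_opts_of_eq_atom hr hO).elim
      · exact h2 l hl hne s hs
    · rcases G.left.exists_atom_or_nonempty with ⟨l, hl⟩ | hne
      · rcases isAtomIn_iff.1 hs with h | h | ⟨O, hO | hO, -⟩
        · exact h1 s r h hr
        · rw [hr] at h; injection h with h; exact h.ge
        · exact (Side.not_mem_opts_of_eq_atom hl hO).elim
        · exact (Side.not_mem_opts_of_eq_atom hr hO).elim
      · exact h3 r hr hne s hs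
  · rintro ⟨h1, h2, h3⟩ K hK
    rcases isFollower_iff.1 hK with rfl | ⟨O, hO, hKO⟩
    · exact ⟨fun l r hl hr => h2 l hl r (isAtomIn_iff.2 (Or.inr (Or.inl hr))),
        fun l hl _ => h2 l hl, fun r hr _ => h3 r hr⟩
    · exact h1 O hO K hKO

theorem Guaranteed.of_isOption {G O : ScoringGame} (h : Guaranteed G) (hO : IsOption O G) :
    Guaranteed O :=
  (guaranteed_iff.1 h).1 O hO

theorem Guaranteed.left_atom_le {G : ScoringGame} (h : Guaranteed G) {l s : ℝ}
    (hl : G.left = Side.atom l) (hs : IsAtomIn s G) : l ≤ s :=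
  (guaranteed_iff.1 h).2.1 l hl s hs

theorem Guaranteed.le_right_atom {G : ScoringGame} (h : Guaranteed G) {r s : ℝ}
    (hr : G.right = Side.atom r) (hs : IsAtomIn s G) : s ≤ r :=
  (guaranteed_iff.1 h).2.2 r hr s hs

theorem isAtomIn_Ls_and_Rs (G : ScoringGame) : IsAtomIn (Ls G) G ∧ IsAtomIn (Rs G) G := by
  induction G using ScoringGame.induction with
  | h G ih =>
    constructor
    · rcases G.left.exists_atom_or_nonempty with ⟨x, hx⟩ | hne
      · rw [Ls_of_atom hx]; exact isAtomIn_iff.2 (Or.inl hx)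
      · obtain ⟨A, hA, e⟩ := exists_Ls_eq hne
        rw [e]; exact (ih A (Or.inl hA)).2.of_isOption (Or.inl hA)
    · rcases G.right.exists_atom_or_nonempty with ⟨x, hx⟩ | hne
      · rw [Rs_of_atom hx]; exact isAtomIn_iff.2 (Or.inr (Or.inl hx))
      · obtain ⟨A, hA, e⟩ := exists_Rs_eq hne
        rw [e]; exact (ih A (Or.inr hA)).1.of_isOption (Or.inr hA)

theorem isAtomIn_Ls (G : ScoringGame) : IsAtomIn (Ls G) G := (isAtomIn_Ls_and_Rs G).1

theorem isAtomIn_Rs (G : ScoringGame) : IsAtomIn (Rs G) G := (isAtomIn_Ls_and_Rs G).2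

theorem IsOption.add_cases {O G H : ScoringGame} (h : IsOption O (G + H)) :
    (∃ A, IsOption A G ∧ O = A + H) ∨ ∃ B, IsOption B H ∧ O = G + B := by
  unfold IsOption at h
  rw [left_opts_add, right_opts_add] at h
  rcases h with (⟨A, hA, rfl⟩ | ⟨B, hB, rfl⟩) | (⟨A, hA, rfl⟩ | ⟨B, hB, rfl⟩)
  · exact Or.inl ⟨A, Or.inl hA, rfl⟩
  · exact Or.inr ⟨B, Or.inl hB, rfl⟩
  · exact Or.inl ⟨A, Or.inr hA, rfl⟩
  · exact Or.inr ⟨B, Or.inr hB, rfl⟩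

theorem eq_atom_add_of_left {G H : ScoringGame} {s : ℝ} (h : (G + H).left = Side.atom s) :
    ∃ x y, G.left = Side.atom x ∧ H.left = Side.atom y ∧ s = x + y := by
  have hne := Side.opts_of_eq_atom h
  rw [left_opts_add, Set.union_empty_iff, Set.image_eq_empty, Set.image_eq_empty,
    ← Set.not_nonempty_iff_eq_empty, ← Set.not_nonempty_iff_eq_empty] at hne
  obtain ⟨x, hx⟩ := G.left.exists_atom_or_nonempty.resolve_right hne.1
  obtain ⟨y, hy⟩ := H.left.exists_atom_or_nonempty.resolve_right hne.2
  rw [left_add_eq_atom hx hy] at h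
  injection h with h
  exact ⟨x, y, hx, hy, h.symm⟩

theorem eq_atom_add_of_right {G H : ScoringGame} {s : ℝ} (h : (G + H).right = Side.atom s) :
    ∃ x y, G.right = Side.atom x ∧ H.right = Side.atom y ∧ s = x + y := by
  have hne := Side.opts_of_eq_atom h
  rw [right_opts_add, Set.union_empty_iff, Set.image_eq_empty, Set.image_eq_empty,
    ← Set.not_nonempty_iff_eq_empty, ← Set.not_nonempty_iff_eq_empty] at hne
  obtain ⟨x, hx⟩ := G.right.exists_atom_or_nonempty.resolve_right hne.1
  obtain ⟨y, hy⟩ := H.right.exists_atom_or_nonempty.resolve_right hne.2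
  rw [right_add_eq_atom hx hy] at h
  injection h with h
  exact ⟨x, y, hx, hy, h.symm⟩

theorem IsAtomIn.of_add {s : ℝ} {G H : ScoringGame} (h : IsAtomIn s (G + H)) :
    ∃ a b, IsAtomIn a G ∧ IsAtomIn b H ∧ s = a + b := by
  induction G using ScoringGame.induction generalizing H with
  | h G ihG =>
  induction H using ScoringGame.induction with
  | h H ihH =>
    rcases isAtomIn_iff.1 h with h | h | ⟨O, hO, hs⟩
    · obtain ⟨x, y, hx, hy, e⟩ := eq_atom_add_of_left h
      exact ⟨x, y, isAtomIn_iff.2 (Or.inl hx), isAtomIn_iff.2 (Or.inl hy), e⟩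
    · obtain ⟨x, y, hx, hy, e⟩ := eq_atom_add_of_right h
      exact ⟨x, y, isAtomIn_iff.2 (Or.inr (Or.inl hx)), isAtomIn_iff.2 (Or.inr (Or.inl hy)), e⟩
    · rcases hO.add_cases with ⟨A, hA, rfl⟩ | ⟨B, hB, rfl⟩
      · obtain ⟨a, b, ha, hb, e⟩ := ihG A hA hs
        exact ⟨a, b, ha.of_isOption hA, hb, e⟩
      · obtain ⟨a, b, ha, hb, e⟩ := ihH B hB hs
        exact ⟨a, b, ha, hb.of_isOption hB, e⟩

theorem Guaranteed.add {G H : ScoringGame} (hG : Guaranteed G) (hH : Guaranteed H) :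
    Guaranteed (G + H) := by
  induction G using ScoringGame.induction generalizing H with
  | h G ihG =>
  induction H using ScoringGame.induction with
  | h H ihH =>
    refine guaranteed_iff.2 ⟨fun O hO => ?_, fun l hl s hs => ?_, fun r hr s hs => ?_⟩
    · rcases hO.add_cases with ⟨A, hA, rfl⟩ | ⟨B, hB, rfl⟩
      · exact ihG A hA (hG.of_isOption hA) hH
      · exact ihH B hB (hH.of_isOption hB)
    · obtain ⟨x, y, hx, hy, rfl⟩ := eq_atom_add_of_left hl
      obtain ⟨a, b, ha, hb, rfl⟩ := hs.of_add
      exact add_le_add (hG.left_atom_le hx ha) (hH.left_atom_le hy hb)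
    · obtain ⟨x, y, hx, hy, rfl⟩ := eq_atom_add_of_right hr
      obtain ⟨a, b, ha, hb, rfl⟩ := hs.of_add
      exact add_le_add (hG.le_right_atom hx ha) (hH.le_right_atom hy hb)

theorem guaranteed_number (s : ℝ) : Guaranteed (number s) := by
  have aux : ∀ t, IsAtomIn t (number s) → t = s := by
    intro t ht
    rcases isAtomIn_iff.1 ht with h | h | ⟨O, hO | hO, -⟩
    · rw [left_number] at h; injection h with h; exact h.symm
    · rw [right_number] at h; injection h with h; exact h.symm
    · exact (Side.not_mem_opts_of_eq_atom (left_number s) hO).elim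
    · exact (Side.not_mem_opts_of_eq_atom (right_number s) hO).elim
  refine guaranteed_iff.2 ⟨?_, fun l hl t ht => ?_, fun r hr t ht => ?_⟩
  · rintro O (hO | hO)
    · exact (Side.not_mem_opts_of_eq_atom (left_number s) hO).elim
    · exact (Side.not_mem_opts_of_eq_atom (right_number s) hO).elim
  · rw [aux t ht, aux l (isAtomIn_iff.2 (Or.inl hl))]
  · rw [aux t ht, aux r (isAtomIn_iff.2 (Or.inr (Or.inl hr)))]

/-- A game in which both players can move is guaranteed as soon as its options are. -/
theorem guaranteed_mk_options {S T : Set ScoringGame} (hS : S.Finite) (nS : S.Nonempty)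
    (hT : T.Finite) (nT : T.Nonempty) (gS : ∀ K ∈ S, Guaranteed K) (gT : ∀ K ∈ T, Guaranteed K) :
    Guaranteed (mk (Side.options S hS nS) (Side.options T hT nT)) := by
  refine guaranteed_iff.2 ⟨?_, fun l hl => ?_, fun r hr => ?_⟩
  · rintro O (hO | hO)
    · rw [left_mk] at hO; exact gS O hO
    · rw [right_mk] at hO; exact gT O hO
  · rw [left_mk] at hl; injection hl
  · rw [right_mk] at hr; injection hr

theorem isOption_conj {O G : ScoringGame} : IsOption O (conj G) ↔ IsOption (conj O) G := by
  unfold IsOption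
  rw [← conj_mem_left_opts_conj (A := conj O), ← conj_mem_right_opts_conj (A := conj O), conj_conj]
  exact or_comm

theorem left_conj_eq_atom_iff {G : ScoringGame} {s : ℝ} :
    (conj G).left = Side.atom s ↔ G.right = Side.atom (-s) := by
  constructor
  · intro h
    rw [← conj_conj G, right_conj_eq_atom h]
  · intro h
    rw [left_conj_eq_atom h, neg_neg]

theorem right_conj_eq_atom_iff {G : ScoringGame} {s : ℝ} :
    (conj G).right = Side.atom s ↔ G.left = Side.atom (-s) := by
  constructor
  · intro h
    rw [← conj_conj G, left_conj_eq_atom h]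
  · intro h
    rw [right_conj_eq_atom h, neg_neg]

theorem isAtomIn_conj {s : ℝ} {G : ScoringGame} : IsAtomIn s (conj G) ↔ IsAtomIn (-s) G := by
  induction G using ScoringGame.induction with
  | h G ih =>
    rw [isAtomIn_iff, isAtomIn_iff (G := G), left_conj_eq_atom_iff, right_conj_eq_atom_iff,
      or_left_comm]
    refine or_congr_right (or_congr_right ⟨?_, ?_⟩)
    · rintro ⟨O, hO, hs⟩
      rw [isOption_conj] at hO
      exact ⟨conj O, hO, (ih _ hO).1 (by rwa [conj_conj])⟩
    · rintro ⟨O, hO, hs⟩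
      exact ⟨conj O, isOption_conj.2 (by rwa [conj_conj]), (ih O hO).2 hs⟩

theorem Guaranteed.conj {G : ScoringGame} (h : Guaranteed G) : Guaranteed (conj G) := by
  induction G using ScoringGame.induction with
  | h G ih =>
    refine guaranteed_iff.2 ⟨fun O hO => ?_, fun l hl s hs => ?_, fun r hr s hs => ?_⟩
    · rw [isOption_conj] at hO
      rw [← conj_conj O]
      exact ih _ hO (h.of_isOption hO)
    · exact neg_le_neg_iff.1
        (h.le_right_atom (left_conj_eq_atom_iff.1 hl) (isAtomIn_conj.1 hs))
    · exact neg_le_neg_iff.1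
        (h.left_atom_le (right_conj_eq_atom_iff.1 hr) (isAtomIn_conj.1 hs))

theorem eq_zero_of_isAtomIn_waiting {n : ℕ} {s : ℝ} (h : IsAtomIn s (waiting n)) : s = 0 := by
  induction n with
  | zero =>
    exact le_antisymm ((guaranteed_number 0).le_right_atom (right_number 0) h)
      ((guaranteed_number 0).left_atom_le (left_number 0) h)
  | succ n ih =>
    rcases isAtomIn_iff.1 h with h | h | ⟨O, hO | hO, hs⟩
    · have := Side.opts_of_eq_atom h
      rw [left_opts_waiting_succ] at this
      exact (Set.singleton_ne_empty _ this).elim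
    · rw [right_waiting] at h; injection h with h; exact h.symm
    · rw [left_opts_waiting_succ] at hO
      exact ih (hO ▸ hs)
    · exact (Side.not_mem_opts_of_eq_atom (right_waiting _) hO).elim

theorem guaranteed_waiting (n : ℕ) : Guaranteed (waiting n) := by
  induction n with
  | zero => exact guaranteed_number 0
  | succ n ih =>
    refine guaranteed_iff.2 ⟨?_, fun l hl s hs => ?_, fun r hr s hs => ?_⟩
    · rintro O (hO | hO)
      · rw [left_opts_waiting_succ] at hO; exact hO ▸ ih
      · exact (Side.not_mem_opts_of_eq_atom (right_waiting _) hO).elim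
    · rw [eq_zero_of_isAtomIn_waiting hs, eq_zero_of_isAtomIn_waiting (isAtomIn_iff.2 (Or.inl hl))]
    · rw [eq_zero_of_isAtomIn_waiting hs,
        eq_zero_of_isAtomIn_waiting (isAtomIn_iff.2 (Or.inr (Or.inl hr)))]

theorem eq_zero_of_isAtomIn_conj_waiting {n : ℕ} {s : ℝ} (h : IsAtomIn s (conj (waiting n))) :
    s = 0 :=
  neg_eq_zero.1 (eq_zero_of_isAtomIn_waiting (isAtomIn_conj.1 h))

theorem eq_of_isAtomIn_number_add_waiting {r s : ℝ} {n : ℕ}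
    (h : IsAtomIn s (number r + waiting n)) : s = r := by
  obtain ⟨a, b, ha, hb, rfl⟩ := h.of_add
  rw [eq_zero_of_isAtomIn_waiting hb, add_zero]
  exact le_antisymm ((guaranteed_number r).le_right_atom (right_number r) ha)
    ((guaranteed_number r).left_atom_le (left_number r) ha)

theorem exists_atom_lower_bound (G : ScoringGame) : ∃ a, ∀ s, IsAtomIn s G → a ≤ s := by
  suffices h : {s | IsAtomIn s G}.Finite from h.bddBelow
  induction G using ScoringGame.induction with
  | h G ih =>
    have hside : ∀ S : Side ScoringGame, {s | S = Side.atom s}.Finite := fun S =>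
      Set.Subsingleton.finite fun s hs t ht => by
        have e : Side.atom s = Side.atom t := Eq.trans (Eq.symm hs) ht
        injection e
    have hfin : {O | IsOption O G}.Finite := G.left.finite_opts.union G.right.finite_opts
    refine (((hside G.left).union (hside G.right)).union (hfin.biUnion ih)).subset ?_
    intro s hs
    rcases isAtomIn_iff.1 hs with h | h | ⟨O, hO, h⟩
    · exact Or.inl (Or.inl h)
    · exact Or.inl (Or.inr h)
    · exact Or.inr (Set.mem_biUnion hO h)

/-! ### The order and its behaviour under conjugation -/

theorem Ge.trans {G H K : ScoringGame} (h₁ : Ge G H) (h₂ : Ge H K) : Ge G K := fun X hX =>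
  ⟨(h₂ X hX).1.trans (h₁ X hX).1, (h₂ X hX).2.trans (h₁ X hX).2⟩

theorem Equivalent.symm {G H : ScoringGame} (h : Equivalent G H) : Equivalent H G := ⟨h.2, h.1⟩

theorem Ge.conj {G H : ScoringGame} (h : Ge G H) : Ge (conj H) (conj G) := by
  intro X hX
  have key : ∀ K : ScoringGame, ScoringGame.conj K + X
      = ScoringGame.conj (K + ScoringGame.conj X) := fun K => by
    rw [conj_add, conj_conj]
  rw [key, key, (stops_conj _).1, (stops_conj _).1, (stops_conj _).2, (stops_conj _).2]
  exact ⟨neg_le_neg (h _ hX.conj).2, neg_le_neg (h _ hX.conj).1⟩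

theorem ge_conj_iff {G H : ScoringGame} : Ge (conj G) (conj H) ↔ Ge H G :=
  ⟨fun h => by simpa only [conj_conj] using h.conj, Ge.conj⟩

/-! ### Separating incomparable games -/

/-- If `G ⋡ H`, a difference in the Right-stops of `G + X` and `H + X` turns into one in the
Left-stops of `G + Y` and `H + Y`, where `Y` offers Left a move to `X` and Right a move to a number
so low that Left has to move to `X` at once. The scores are then shifted so that `0` separates
them. -/
theorem exists_Ls_separating {G H : ScoringGame} (h : ¬ Ge G H) :
    ∃ X, Guaranteed X ∧ Ls (G + X) < 0 ∧ 0 < Ls (H + X) := by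
  suffices h' : ∃ X, Guaranteed X ∧ Ls (G + X) < Ls (H + X) by
    obtain ⟨X, hX, hlt⟩ := h'
    refine ⟨X + number (-((Ls (G + X) + Ls (H + X)) / 2)), hX.add (guaranteed_number _), ?_, ?_⟩
    · rw [← ScoringGame.add_assoc, Ls_add_number]; linarith
    · rw [← ScoringGame.add_assoc, Ls_add_number]; linarith
  unfold Ge at h
  push Not at h
  obtain ⟨X, hX, hlt⟩ := h
  by_cases hL : Ls (G + X) < Ls (H + X)
  · exact ⟨X, hX, hL⟩
  have hR := hlt (not_lt.1 hL)
  obtain ⟨m, hm⟩ := (G.left.finite_opts.image Ls).bddAbove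
  let c := Rs (H + X) - m - 1
  let Y := mk (Side.options {X} (Set.finite_singleton X) (Set.singleton_nonempty X))
    (Side.options {number c} (Set.finite_singleton _) (Set.singleton_nonempty _))
  have hYl : Y.left.opts = {X} := congrArg Side.opts (left_mk _ _)
  have hYr : Y.right.opts = {number c} := congrArg Side.opts (right_mk _ _)
  have hY : Guaranteed Y := guaranteed_mk_options _ _ _ _
    (fun K hK => by rw [Set.mem_singleton_iff] at hK; exact hK ▸ hX)
    (fun K hK => by rw [Set.mem_singleton_iff] at hK; exact hK ▸ guaranteed_number c)
  refine ⟨Y, hY, lt_of_lt_of_le ?_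
    (Rs_le_Ls_of_mem_left (add_mem_left_opts_of_right (by rw [hYl]; exact Set.mem_singleton X)))⟩
  obtain ⟨A, hA, e⟩ := exists_Ls_eq (G := G + Y)
    ⟨G + X, add_mem_left_opts_of_right (by rw [hYl]; exact Set.mem_singleton X)⟩
  rw [e]
  rw [left_opts_add, hYl, Set.image_singleton] at hA
  rcases hA with ⟨K, hK, rfl⟩ | rfl
  · have h1 : Rs (K + Y) ≤ Ls (K + number c) :=
      Rs_le_Ls_of_mem_right (add_mem_right_opts_of_right (by rw [hYr]; exact Set.mem_singleton _))
    have h2 : Ls K ≤ m := hm ⟨K, hK, rfl⟩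
    rw [Ls_add_number] at h1
    simp only [c] at h1
    linarith
  · exact hR

theorem exists_Rs_separating {G H : ScoringGame} (h : ¬ Ge G H) :
    ∃ X, Guaranteed X ∧ Rs (G + X) < 0 ∧ 0 < Rs (H + X) := by
  obtain ⟨X, hX, h1, h2⟩ := exists_Ls_separating (mt ge_conj_iff.1 h)
  refine ⟨conj X, hX.conj, ?_, ?_⟩
  · have := (stops_conj (G + conj X)).1
    rw [conj_add, conj_conj] at this
    linarith
  · have := (stops_conj (H + conj X)).1
    rw [conj_add, conj_conj] at this
    linarith

/-- If no Left option of `G` is `≽ H` and `G` is `≽` no Right option of `H`, then some `T` makes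
`G + T` bad for Left even if Left starts and `H + T` good for Left even if Right starts. The Right
options of `T` refute every `G^L`, its Left options answer every `H^R`, and one number on either
side makes `T` have options even if `G` has no Left options or `H` no Right options. -/
theorem exists_downlink {G H : ScoringGame} (hG : ∀ A ∈ G.left.opts, ¬ Ge A H)
    (hH : ∀ B ∈ H.right.opts, ¬ Ge G B) : ∃ T, Guaranteed T ∧ Ls (G + T) < Rs (H + T) := by
  have : Nonempty ScoringGame := ⟨number 0⟩
  choose! X gX hX₁ hX₂ using fun A hA => exists_Ls_separating (hG A hA)
  choose! Y gY hY₁ hY₂ using fun B hB => exists_Rs_separating (hH B hB)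
  let p := number (-Rs G - 1)
  let q := number (1 - Ls H)
  let T := mk
    (Side.options (insert p (Y '' H.right.opts)) ((H.right.finite_opts.image Y).insert p)
      (Set.insert_nonempty _ _))
    (Side.options (insert q (X '' G.left.opts)) ((G.left.finite_opts.image X).insert q)
      (Set.insert_nonempty _ _))
  have hTl : T.left.opts = insert p (Y '' H.right.opts) := congrArg Side.opts (left_mk _ _)
  have hTr : T.right.opts = insert q (X '' G.left.opts) := congrArg Side.opts (right_mk _ _)
  refine ⟨T, guaranteed_mk_options _ _ _ _ ?_ ?_, lt_trans (b := 0) ?_ ?_⟩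
  · rintro K (rfl | ⟨B, hB, rfl⟩)
    · exact guaranteed_number _
    · exact gY B hB
  · rintro K (rfl | ⟨A, hA, rfl⟩)
    · exact guaranteed_number _
    · exact gX A hA
  · obtain ⟨K, hK, e⟩ := exists_Ls_eq (G := G + T)
      ⟨G + p, add_mem_left_opts_of_right (by rw [hTl]; exact Set.mem_insert _ _)⟩
    rw [e]
    rw [left_opts_add, hTl] at hK
    rcases hK with ⟨A, hA, rfl⟩ | ⟨_, rfl | ⟨B, hB, rfl⟩, rfl⟩
    · exact (Rs_le_Ls_of_mem_right (add_mem_right_opts_of_right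
        (by rw [hTr]; exact Or.inr ⟨A, hA, rfl⟩))).trans_lt (hX₁ A hA)
    · simp only [p, Rs_add_number]; linarith
    · exact hY₁ B hB
  · obtain ⟨K, hK, e⟩ := exists_Rs_eq (G := H + T)
      ⟨H + q, add_mem_right_opts_of_right (by rw [hTr]; exact Set.mem_insert _ _)⟩
    rw [e]
    rw [right_opts_add, hTr] at hK
    rcases hK with ⟨B, hB, rfl⟩ | ⟨_, rfl | ⟨A, hA, rfl⟩, rfl⟩
    · exact (hY₂ B hB).trans_le (Rs_le_Ls_of_mem_left (add_mem_left_opts_of_right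
        (by rw [hTl]; exact Or.inr ⟨B, hB, rfl⟩)))
    · simp only [q, Ls_add_number]; linarith
    · exact hX₂ A hA

/-- Every Left move in the smaller game is answered: by a better Left option of the larger game, or
by a Right reply to it that the larger game dominates. -/
theorem Ge.left_maintenance {G H A : ScoringGame} (h : Ge G H) (hA : A ∈ H.left.opts) :
    (∃ B ∈ G.left.opts, Ge B A) ∨ ∃ B ∈ A.right.opts, Ge G B := by
  by_contra! hcon
  obtain ⟨T, hT, hlt⟩ := exists_downlink hcon.1 hcon.2
  exact absurd (h T hT).1
    (not_le.2 (hlt.trans_le (Rs_le_Ls_of_mem_left (add_mem_left_opts_of_left hA))))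

/-- Every Right move in the larger game is answered. -/
theorem Ge.right_maintenance {G H A : ScoringGame} (h : Ge G H) (hA : A ∈ G.right.opts) :
    (∃ B ∈ H.right.opts, Ge A B) ∨ ∃ B ∈ A.left.opts, Ge B H := by
  by_contra! hcon
  obtain ⟨T, hT, hlt⟩ := exists_downlink hcon.2 hcon.1
  exact absurd (h T hT).2
    (not_le.2 ((Rs_le_Ls_of_mem_right (add_mem_right_opts_of_left hA)).trans_lt hlt))

/-! ### Pass-allowed stops -/

theorem left_opts_add_conj_waiting (G : ScoringGame) (n : ℕ) :
    (G + conj (waiting n)).left.opts = (fun X => X + conj (waiting n)) '' G.left.opts := by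
  rw [left_opts_add, Side.opts_of_eq_atom (left_conj_waiting n), Set.image_empty, Set.union_empty]

theorem left_add_conj_waiting {G : ScoringGame} {x : ℝ} (h : G.left = Side.atom x) (n : ℕ) :
    (G + conj (waiting n)).left = Side.atom x := by
  rw [left_add_eq_atom h (left_conj_waiting n), add_zero]

theorem Ls_add_conj_waiting_zero (G : ScoringGame) : Ls (G + conj (waiting 0)) = Ls G := by
  rw [conj_waiting_zero, Ls_add_number, add_zero]

theorem Rs_add_conj_waiting_zero (G : ScoringGame) : Rs (G + conj (waiting 0)) = Rs G := by
  rw [conj_waiting_zero, Rs_add_number, add_zero]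

theorem Rs_add_conj_waiting_succ_le (G : ScoringGame) (n : ℕ) :
    Rs (G + conj (waiting (n + 1))) ≤ Ls (G + conj (waiting n)) :=
  Rs_le_Ls_of_mem_right (add_mem_right_opts_of_right
    (by rw [right_opts_conj_waiting_succ]; exact Set.mem_singleton _))

/-- In a guaranteed game one more waiting move never hurts Right. -/
theorem stops_add_conj_waiting_succ_le {G : ScoringGame} (hG : Guaranteed G) (n : ℕ) :
    Ls (G + conj (waiting (n + 1))) ≤ Ls (G + conj (waiting n)) ∧
      Rs (G + conj (waiting (n + 1))) ≤ Rs (G + conj (waiting n)) := by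
  induction G using ScoringGame.induction generalizing n with
  | h G ihG =>
  induction n with
  | zero =>
    constructor
    · rcases G.left.exists_atom_or_nonempty with ⟨x, hx⟩ | hne
      · rw [Ls_of_atom (left_add_conj_waiting hx _), Ls_of_atom (left_add_conj_waiting hx _)]
      · obtain ⟨A, hA, e⟩ := exists_Ls_eq (G := G + conj (waiting (0 + 1)))
          (by rw [left_opts_add_conj_waiting]; exact hne.image _)
        rw [left_opts_add_conj_waiting] at hA
        obtain ⟨B, hB, rfl⟩ := hA
        rw [e]
        exact (ihG B (Or.inl hB) (hG.of_isOption (Or.inl hB)) 0).2.trans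
          (Rs_le_Ls_of_mem_left (add_mem_left_opts_of_left hB))
    · rw [Rs_add_conj_waiting_zero]
      rcases G.right.exists_atom_or_nonempty with ⟨x, hx⟩ | hne
      · rw [Rs_of_atom hx]
        refine (Rs_add_conj_waiting_succ_le G 0).trans ?_
        rw [Ls_add_conj_waiting_zero]
        exact hG.le_right_atom hx (isAtomIn_Ls G)
      · obtain ⟨A, hA, e⟩ := exists_Rs_eq hne
        rw [e]
        refine (Rs_le_Ls_of_mem_right (add_mem_right_opts_of_left hA)).trans
          ((ihG A (Or.inr hA) (hG.of_isOption (Or.inr hA)) 0).1.trans ?_)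
        rw [Ls_add_conj_waiting_zero]
  | succ n ihn =>
    constructor
    · rcases G.left.exists_atom_or_nonempty with ⟨x, hx⟩ | hne
      · rw [Ls_of_atom (left_add_conj_waiting hx _), Ls_of_atom (left_add_conj_waiting hx _)]
      · obtain ⟨A, hA, e⟩ := exists_Ls_eq (G := G + conj (waiting (n + 1 + 1)))
          (by rw [left_opts_add_conj_waiting]; exact hne.image _)
        rw [left_opts_add_conj_waiting] at hA
        obtain ⟨B, hB, rfl⟩ := hA
        rw [e]
        exact (ihG B (Or.inl hB) (hG.of_isOption (Or.inl hB)) (n + 1)).2.trans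
          (Rs_le_Ls_of_mem_left (add_mem_left_opts_of_left hB))
    · obtain ⟨A, hA, e⟩ := exists_Rs_eq (G := G + conj (waiting (n + 1)))
        ⟨G + conj (waiting n), add_mem_right_opts_of_right
          (by rw [right_opts_conj_waiting_succ]; exact Set.mem_singleton _)⟩
      rw [e]
      rw [right_opts_add, right_opts_conj_waiting_succ, Set.image_singleton] at hA
      rcases hA with ⟨B, hB, rfl⟩ | rfl
      · exact (Rs_le_Ls_of_mem_right (add_mem_right_opts_of_left hB)).trans
          (ihG B (Or.inr hB) (hG.of_isOption (Or.inr hB)) (n + 1)).1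
      · exact (Rs_add_conj_waiting_succ_le G (n + 1)).trans ihn.1

theorem antitone_Rs_add_conj_waiting {G : ScoringGame} (hG : Guaranteed G) :
    Antitone fun n => Rs (G + conj (waiting n)) :=
  antitone_nat_of_succ_le fun n => (stops_add_conj_waiting_succ_le hG n).2

theorem exists_le_stops_add_conj_waiting (G : ScoringGame) :
    ∃ a, ∀ n, a ≤ Ls (G + conj (waiting n)) ∧ a ≤ Rs (G + conj (waiting n)) := by
  obtain ⟨a, ha⟩ := exists_atom_lower_bound G
  have key : ∀ n s, IsAtomIn s (G + conj (waiting n)) → a ≤ s := by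
    intro n s hs
    obtain ⟨x, y, hx, hy, rfl⟩ := hs.of_add
    rw [eq_zero_of_isAtomIn_conj_waiting hy, add_zero]
    exact ha x hx
  exact ⟨a, fun n => ⟨key n _ (isAtomIn_Ls _), key n _ (isAtomIn_Rs _)⟩⟩

theorem bddBelow_range_Ls (G : ScoringGame) :
    BddBelow (Set.range fun n => Ls (G + conj (waiting n))) := by
  obtain ⟨a, ha⟩ := exists_le_stops_add_conj_waiting G
  exact ⟨a, Set.forall_mem_range.2 fun n => (ha n).1⟩

theorem bddBelow_range_Rs (G : ScoringGame) :
    BddBelow (Set.range fun n => Rs (G + conj (waiting n))) := by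
  obtain ⟨a, ha⟩ := exists_le_stops_add_conj_waiting G
  exact ⟨a, Set.forall_mem_range.2 fun n => (ha n).2⟩

theorem underLs_of_atom {G : ScoringGame} {x : ℝ} (h : G.left = Side.atom x) : underLs G = x := by
  simp only [underLs, Ls_of_atom (left_add_conj_waiting h _), ciInf_const]

theorem Equivalent.underLs_eq {G H : ScoringGame} (h : Equivalent G H) :
    underLs G = underLs H :=
  iInf_congr fun n => le_antisymm (h.2 _ (guaranteed_waiting n).conj).1
    (h.1 _ (guaranteed_waiting n).conj).1

theorem underRs_le_underLs {G A : ScoringGame} (hA : A ∈ G.left.opts) :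
    underRs A ≤ underLs G :=
  ciInf_mono (bddBelow_range_Rs A) fun _ => Rs_le_Ls_of_mem_left (add_mem_left_opts_of_left hA)

/-- The minimum over the number of waiting moves commutes with Left's choice of an option: if every
option fell below `underLs G` for some number of waiting moves, then all would do so at once, by
monotonicity and finiteness. -/
theorem exists_underLs_eq {G : ScoringGame} (hG : Guaranteed G) (hne : G.left.opts.Nonempty) :
    ∃ A ∈ G.left.opts, underLs G = underRs A := by
  by_contra! hcon
  have hlt : ∀ A ∈ G.left.opts, ∃ n, Rs (A + conj (waiting n)) < underLs G := fun A hA =>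
    exists_lt_of_ciInf_lt (lt_of_le_of_ne (underRs_le_underLs hA) (hcon A hA).symm)
  choose! n hn using hlt
  obtain ⟨N, hN⟩ := (G.left.finite_opts.image n).bddAbove
  obtain ⟨K, hK, e⟩ := exists_Ls_eq (G := G + conj (waiting N))
    (by rw [left_opts_add_conj_waiting]; exact hne.image _)
  rw [left_opts_add_conj_waiting] at hK
  obtain ⟨A, hA, rfl⟩ := hK
  have h1 : underLs G ≤ Rs (A + conj (waiting N)) := e ▸ ciInf_le (bddBelow_range_Ls G) N
  have h2 : Rs (A + conj (waiting N)) ≤ Rs (A + conj (waiting (n A))) :=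
    antitone_Rs_add_conj_waiting (hG.of_isOption (Or.inl hA)) (hN ⟨A, hA, rfl⟩)
  exact (hn A hA).not_ge (h1.trans h2)

theorem underRs_number_add_conj_waiting (l : ℝ) (n : ℕ) :
    underRs (number l + conj (waiting n)) = l := by
  have key : ∀ m, Rs (number l + conj (waiting n) + conj (waiting m)) = l := by
    intro m
    obtain ⟨x, y, hx, hy, e⟩ := (isAtomIn_Rs (number l + conj (waiting n) + conj (waiting m))).of_add
    obtain ⟨z, w, hz, hw, rfl⟩ := hx.of_add
    rw [e, eq_zero_of_isAtomIn_conj_waiting hy, eq_zero_of_isAtomIn_conj_waiting hw, add_zero,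
      add_zero]
    exact le_antisymm ((guaranteed_number l).le_right_atom (right_number l) hz)
      ((guaranteed_number l).left_atom_le (left_number l) hz)
  simp only [underRs, key, ciInf_const]

/-! ### Games with large atoms dominate a number minus many waiting moves -/

/-- In `K + X` Left plays as in `ℓ - n̂ + X`, the moves of Right in `K` playing the part of the
waiting moves. If Left runs out of moves in `X`, then by the guaranteed property of `X` the
outcome can only be better than in `ℓ - n̂ + X`. -/
theorem exists_forall_ge_number_add_conj_waiting {l : ℝ} {K : ScoringGame}
    (hK : ∀ s, IsAtomIn s K → l ≤ s) :
    ∃ N, ∀ n, N ≤ n → Ge K (number l + conj (waiting n)) := by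
  induction K using ScoringGame.induction with
  | h K ihK =>
    have hopt : ∀ A ∈ K.right.opts, ∃ N, ∀ n, N ≤ n → Ge A (number l + conj (waiting n)) :=
      fun A hA => ihK A (Or.inr hA) fun s hs => hK s (hs.of_isOption (Or.inr hA))
    choose! f hf using hopt
    obtain ⟨M, hM⟩ := (K.right.finite_opts.image f).bddAbove
    refine ⟨M + 1, fun n hn X hX => ?_⟩
    obtain ⟨n, rfl⟩ : ∃ k, n = k + 1 := ⟨n - 1, by omega⟩
    induction X using ScoringGame.induction with
    | h X ihX =>
      constructor
      · rcases X.left.exists_atom_or_nonempty with ⟨x, hx⟩ | hne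
        · rw [ge_iff_le, Ls_of_atom (left_add_eq_atom (left_number_add_conj_waiting l _) hx)]
          obtain ⟨a, b, ha, hb, e⟩ := (isAtomIn_Ls (K + X)).of_add
          rw [e]
          exact add_le_add (hK a ha) (hX.left_atom_le hx hb)
        · obtain ⟨A, hA, e⟩ := exists_Ls_eq (G := number l + conj (waiting (n + 1)) + X)
            (by rw [left_opts_add]; exact (hne.image _).inr)
          rw [left_opts_add, Side.opts_of_eq_atom (left_number_add_conj_waiting l _),
            Set.image_empty, Set.empty_union] at hA
          obtain ⟨B, hB, rfl⟩ := hA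
          rw [ge_iff_le, e]
          exact (ihX B (Or.inl hB) (hX.of_isOption (Or.inl hB))).2.trans
            (Rs_le_Ls_of_mem_left (add_mem_left_opts_of_right hB))
      · have hpass : Rs (number l + conj (waiting (n + 1)) + X) ≤
            Ls (number l + conj (waiting n) + X) :=
          Rs_le_Ls_of_mem_right (add_mem_right_opts_of_left
            (by rw [right_opts_number_add_conj_waiting_succ]; exact Set.mem_singleton _))
        by_cases hne : (K + X).right.opts.Nonempty
        · obtain ⟨A, hA, e⟩ := exists_Rs_eq hne
          rw [ge_iff_le, e]
          rw [right_opts_add] at hA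
          rcases hA with ⟨B, hB, rfl⟩ | ⟨B, hB, rfl⟩
          · have hfB : f B ≤ n := (hM ⟨B, hB, rfl⟩).trans (by omega)
            exact hpass.trans (hf B hB n hfB X hX).1
          · exact (Rs_le_Ls_of_mem_right (add_mem_right_opts_of_right hB)).trans
              (ihX B (Or.inr hB) (hX.of_isOption (Or.inr hB))).1
        · obtain ⟨r, hr⟩ := (K + X).right.exists_atom_or_nonempty.resolve_right hne
          obtain ⟨k, x, hk, hx, rfl⟩ := eq_atom_add_of_right hr
          rw [ge_iff_le, Rs_of_atom hr]
          refine hpass.trans ?_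
          obtain ⟨a, b, ha, hb, e⟩ := (isAtomIn_Ls (number l + conj (waiting n) + X)).of_add
          obtain ⟨c, d, hc, hd, rfl⟩ := ha.of_add
          rw [e, eq_zero_of_isAtomIn_conj_waiting hd, add_zero]
          exact add_le_add
            (((guaranteed_number l).le_right_atom (right_number l) hc).trans
              (hK k (isAtomIn_iff.2 (Or.inr (Or.inl hk)))))
            (hX.le_right_atom hx hb)

/-! ### Conjugation exchanges the reductions on the two sides -/

theorem overRs_conj (G : ScoringGame) : overRs (conj G) = -underLs G := by
  rw [underLs, iInf, ← Real.sSup_neg, overRs, iSup, ← Set.image_neg_eq_neg, ← Set.range_comp]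
  refine congrArg (fun f : ℕ → ℝ => sSup (Set.range f)) (funext fun n => ?_)
  rw [Function.comp_apply, ← (stops_conj _).2, conj_add, conj_conj]

theorem overLs_conj (G : ScoringGame) : overLs (conj G) = -underRs G := by
  rw [underRs, iInf, ← Real.sSup_neg, overLs, iSup, ← Set.image_neg_eq_neg, ← Set.range_comp]
  refine congrArg (fun f : ℕ → ℝ => sSup (Set.range f)) (funext fun n => ?_)
  rw [Function.comp_apply, ← (stops_conj _).1, conj_add, conj_conj]

theorem left_conj_congr {G H : ScoringGame} (h : G.right = H.right) :
    (conj G).left = (conj H).left := by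
  rw [conj, left_mk, conj, left_mk, h]

theorem right_conj_congr {G H : ScoringGame} (h : G.left = H.left) :
    (conj G).right = (conj H).right := by
  rw [conj, right_mk, conj, right_mk, h]

theorem LeftReversible.conj {G A B : ScoringGame} (h : LeftReversible G A B) :
    RightReversible (conj G) (conj A) (conj B) :=
  ⟨conj_mem_right_opts_conj.2 h.1, conj_mem_left_opts_conj.2 h.2.1, h.2.2.conj⟩

theorem conj_mk_atom_singleton (l : ℝ) (B : ScoringGame) :
    conj (mk (Side.atom l) (Side.ofFamily fun _ : Unit => B)) =
      mk (Side.ofFamily fun _ : Unit => conj B) (Side.atom (-l)) := by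
  apply ext_sides
  · refine Side.eq_of_opts_eq ?_ ?_
    · rw [left_opts_conj, right_mk, left_mk, Side.opts_ofFamily, Side.opts_ofFamily, Set.range_const,
        Set.range_const, Set.image_singleton]
    · rw [left_opts_conj, right_mk, Side.opts_ofFamily]
      exact (Set.range_nonempty _).image _
  · rw [right_conj_eq_atom (left_mk _ _), right_mk]

theorem conj_number_add_conj_waiting (l : ℝ) (n : ℕ) :
    conj (number l + conj (waiting n)) = number (-l) + waiting n := by
  rw [conj_add, conj_conj, conj_number]

theorem conj_mk_atom_left (l : ℝ) (G : ScoringGame) :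
    conj (mk (Side.atom l) G.right) = mk (conj G).left (Side.atom (-l)) :=
  ext_sides ((left_conj_congr (right_mk _ _)).trans (left_mk _ _).symm)
    ((right_conj_eq_atom (left_mk _ _)).trans (right_mk _ _).symm)

theorem LeftReduction.conj {G H : ScoringGame} (h : LeftReduction G H) :
    RightReduction (conj G) (conj H) := by
  have hdiff : ∀ K A : ScoringGame, (ScoringGame.conj K).right.opts \ {ScoringGame.conj A} =
      ScoringGame.conj '' (K.left.opts \ {A}) := fun K A => by
    rw [right_opts_conj, Set.image_sdiff conj_injective, Set.image_singleton]
  have hother : ∀ K A : ScoringGame, (∀ C ∈ K.left.opts \ {A}, underRs C < underRs A) →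
      ∀ C ∈ (ScoringGame.conj K).right.opts \ {ScoringGame.conj A},
        overLs (ScoringGame.conj A) < overLs C := by
    intro K A h C hC
    rw [hdiff] at hC
    obtain ⟨D, hD, rfl⟩ := hC
    rw [overLs_conj, overLs_conj]
    exact neg_lt_neg (h D hD)
  cases h with
  | @domination A B hA hB hAB hdom hl hr =>
    refine .domination (conj_mem_right_opts_conj.2 hA) (conj_mem_right_opts_conj.2 hB)
      (conj_injective.ne hAB) hdom.conj ?_ (left_conj_congr hr)
    rw [hdiff, right_opts_conj, hl]
  | @reversibility A B hrev hB hl hr =>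
    refine .reversibility hrev.conj (by rw [right_opts_conj]; exact hB.image _) ?_
      (left_conj_congr hr)
    rw [hdiff, right_opts_conj, hl, Set.image_union, right_opts_conj]
  | @atomicErase A B C l hrev hB hC hbest hl hr =>
    refine .atomicErase (C := ScoringGame.conj C) hrev.conj (right_conj_eq_atom hB) ?_ ?_ ?_
      (left_conj_congr hr)
    · rw [hdiff]; exact ⟨C, hC, rfl⟩
    · rw [overRs_conj, overLs_conj, hbest]
    · rw [hdiff, right_opts_conj, hl]
  | @atomicReplace A B l hrev hB hA hoth hl hr =>
    refine .atomicReplace hrev.conj (right_conj_eq_atom hB) ?_ (hother _ _ hoth) ?_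
      (left_conj_congr hr)
    · rw [overRs_conj, overLs_conj, hA]
    · rw [hdiff, right_opts_conj, hl, Set.image_union, Set.image_singleton, conj_mk_atom_singleton]
  | @substituteWaiting A B l n hrev hB hA hoth hn hl hr =>
    refine .substituteWaiting (n := n) hrev.conj (right_conj_eq_atom hB) ?_ (hother _ _ hoth) ?_ ?_
      (left_conj_congr hr)
    · rw [overRs_conj, overLs_conj, hA]
    · simpa only [← conj_number_add_conj_waiting, ge_conj_iff] using hn
    · rw [hdiff, right_opts_conj, hl, Set.image_union, Set.image_singleton,
        conj_number_add_conj_waiting]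
  | @substituteAtom A B l hrev hB hA honly hgs hl hr =>
    refine .substituteAtom hrev.conj (right_conj_eq_atom hB) ?_ ?_ ?_ (right_conj_eq_atom hl)
      (left_conj_congr hr)
    · rw [overRs_conj, overLs_conj, hA]
    · rw [right_opts_conj, honly, Set.image_singleton]
    · rw [← conj_mk_atom_left]; exact hgs.conj

/-! ### Left options of reduced games -/

/-- No reduction on Left's side changes the game itself (its followers are not considered). -/
def LeftReduced (G : ScoringGame) : Prop := ∀ K, LeftReduction G K → K = G

theorem Reduced.leftReduced {G : ScoringGame} (h : Reduced G) : LeftReduced G := fun K hK =>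
  h G Relation.ReflTransGen.refl K (Or.inl hK)

theorem Reduced.leftReduced_conj {G : ScoringGame} (h : Reduced G) : LeftReduced (conj G) := by
  intro K hK
  have := hK.conj
  rw [conj_conj] at this
  rw [← h G Relation.ReflTransGen.refl _ (Or.inr this), conj_conj]

theorem Reduced.of_isOption {G O : ScoringGame} (h : Reduced G) (hO : IsOption O G) : Reduced O :=
  fun K hK => h K (hK.tail hO)

theorem LeftReduced.opts_eq {G : ScoringGame} (hG : LeftReduced G) {S : Set ScoringGame}
    (hS : S.Finite) (nS : S.Nonempty)
    (h : ∀ K : ScoringGame, K.left.opts = S → K.right = G.right → LeftReduction G K) :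
    S = G.left.opts := by
  have e := hG _ (h (mk (Side.options S hS nS) G.right) (congrArg Side.opts (left_mk _ _))
    (right_mk _ _))
  rw [← e, left_mk]
  rfl

theorem LeftReduced.eq_of_ge {G A B : ScoringGame} (hG : LeftReduced G) (hA : A ∈ G.left.opts)
    (hB : B ∈ G.left.opts) (h : Ge B A) : A = B := by
  by_contra hAB
  have e := hG.opts_eq (S := G.left.opts \ {A}) G.left.finite_opts.sdiff
    ⟨B, hB, fun h => hAB h.symm⟩ fun K hl hr => .domination hA hB hAB h hl hr
  rw [← e] at hA
  exact hA.2 rfl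

theorem LeftReduced.exists_atom_of_reversible {G A B : ScoringGame} (hG : LeftReduced G)
    (h : LeftReversible G A B) : ∃ l, B.left = Side.atom l := by
  refine B.left.exists_atom_or_nonempty.resolve_right fun hB => ?_
  have e := hG.opts_eq (S := (G.left.opts \ {A}) ∪ B.left.opts)
    (G.left.finite_opts.sdiff.union B.left.finite_opts) hB.inr
    fun K hl hr => .reversibility h hB hl hr
  have hA := h.1
  rw [← e] at hA
  rcases hA with hA | hA
  · exact hA.2 rfl
  · exact isOption_wf.asymmetric A B (Or.inl hA) (Or.inr h.2.1)

/-- A reversible Left option of a reduced game is the number `ℓ` minus `n + 1` waiting moves, with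
`n` determined by `G` and `ℓ`, and it alone attains the pass-allowed Left-stop `ℓ`. -/
theorem LeftReduced.reversible_option {G A B : ScoringGame} (hG : LeftReduced G)
    (gG : Guaranteed G) (h : LeftReversible G A B) :
    ∃ (l : ℝ) (n : ℕ), A = number l + conj (waiting (n + 1)) ∧
      IsLeast {k : ℕ | Ge G (number l + conj (waiting k))} n ∧ underLs G = l ∧
      (∀ C ∈ G.left.opts, C ≠ A → underRs C < l) ∧
      (G.left.opts = {A} → ¬ Guaranteed (mk (Side.atom l) G.right)) := by
  obtain ⟨l, hB⟩ := hG.exists_atom_of_reversible h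
  have hA := h.1
  have hne : ∀ C ∈ G.left.opts, C ≠ A → underRs C ≠ underLs G := by
    intro C hC hCA hbest
    have e := hG.opts_eq (S := G.left.opts \ {A}) G.left.finite_opts.sdiff ⟨C, hC, hCA⟩
      fun K hl hr => .atomicErase h hB ⟨hC, hCA⟩ hbest.symm hl hr
    rw [← e] at hA
    exact hA.2 rfl
  have hbest : underLs G = underRs A := by
    obtain ⟨C, hC, e⟩ := exists_underLs_eq gG ⟨A, hA⟩
    by_cases hCA : C = A
    · rw [e, hCA]
    · exact absurd e.symm (hne C hC hCA)
  have hother : ∀ C ∈ G.left.opts \ {A}, underRs C < underRs A := fun C hC =>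
    lt_of_le_of_ne (hbest ▸ underRs_le_underLs hC.1) (hbest ▸ hne C hC.1 hC.2)
  have gB : Guaranteed B := (gG.of_isOption (Or.inl hA)).of_isOption (Or.inr h.2.1)
  have hex : {k : ℕ | Ge G (number l + conj (waiting k))}.Nonempty := by
    obtain ⟨N, hN⟩ := exists_forall_ge_number_add_conj_waiting fun s hs => gB.left_atom_le hB hs
    exact ⟨N, h.2.2.trans (hN N le_rfl)⟩
  have hn : IsLeast {k : ℕ | Ge G (number l + conj (waiting k))} (sInf _) :=
    ⟨Nat.sInf_mem hex, fun k hk => Nat.sInf_le hk⟩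
  generalize sInf {k : ℕ | Ge G (number l + conj (waiting k))} = n at hn
  have hAn : A = number l + conj (waiting (n + 1)) := by
    have e := hG.opts_eq (S := {number l + conj (waiting (n + 1))} ∪ (G.left.opts \ {A}))
      ((Set.finite_singleton _).union G.left.finite_opts.sdiff) (Set.singleton_nonempty _).inl
      fun K hl hr => .substituteWaiting h hB hbest hother hn hl hr
    have hA' := hA
    rw [← e] at hA'
    exact hA'.resolve_right fun h => h.2 rfl
  have hRs : underRs A = l := by rw [hAn, underRs_number_add_conj_waiting]
  refine ⟨l, n, hAn, hn, hbest.trans hRs, fun C hC hCA => hRs ▸ hother C ⟨hC, hCA⟩,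
    fun honly hgs => ?_⟩
  have e := hG (mk (Side.atom l) G.right)
    (.substituteAtom h hB hbest honly hgs (left_mk _ _) (right_mk _ _))
  refine Side.not_mem_opts_of_eq_atom (?_ : G.left = Side.atom l) hA
  rw [← e, left_mk]

/-! ### Equivalent reduced games have matching Left options -/

theorem Equivalent.not_ge_of_not_reversible {G H A : ScoringGame} (h : Equivalent G H)
    (hA : ∀ B, ¬ LeftReversible G A B) (hAH : A ∈ G.left.opts) : ∀ B ∈ A.right.opts, ¬ Ge H B :=
  fun B hB hHB => hA B ⟨hAH, hB, h.1.trans hHB⟩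

theorem mem_left_opts_of_not_reversible {G H A : ScoringGame} (hG : LeftReduced G)
    (hH : LeftReduced H) (gH : Guaranteed H) (h : Equivalent G H)
    (ih : ∀ C ∈ G.left.opts, ∀ D ∈ H.left.opts, Equivalent C D → C = D)
    (hA : A ∈ G.left.opts) (hrev : ∀ B, ¬ LeftReversible G A B) : A ∈ H.left.opts := by
  have hHA := h.not_ge_of_not_reversible hrev hA
  obtain ⟨D, hD, hDA⟩ := (h.2.left_maintenance hA).resolve_right
    fun ⟨B, hB, hHB⟩ => hHA B hB hHB
  by_cases hDrev : ∃ B, LeftReversible H D B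
  · obtain ⟨B, hB⟩ := hDrev
    -- Here `D` is `ℓ - (n + 1)^`. Since Left cannot move in `ℓ - n̂`, Right's move from `D` to
    -- `ℓ - n̂` has to be matched by a Right option of `A`, which makes `A` reversible as well.
    obtain ⟨l, n, rfl, hn, -⟩ := hH.reversible_option gH hB
    have hmem : number l + conj (waiting n) ∈ (number l + conj (waiting (n + 1))).right.opts := by
      rw [right_opts_number_add_conj_waiting_succ]; exact Set.mem_singleton _
    rcases hDA.right_maintenance hmem with ⟨C, hC, hge⟩ | ⟨C, hC, -⟩
    · exact absurd (hn.1.trans hge) (hHA C hC)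
    · exact (Side.not_mem_opts_of_eq_atom (left_number_add_conj_waiting l n) hC).elim
  · push Not at hDrev
    obtain ⟨C, hC, hCD⟩ := (h.1.left_maintenance hD).resolve_right
      fun ⟨B, hB, hGB⟩ => h.symm.not_ge_of_not_reversible hDrev hD B hB hGB
    -- `C ≽ D ≽ A` and no option of `G` is dominated.
    obtain rfl : A = C := hG.eq_of_ge hA hC (hCD.trans hDA)
    exact ih A hA D hD ⟨hCD, hDA⟩ ▸ hD

theorem mem_left_opts_of_nonempty {G H A : ScoringGame} (hG : LeftReduced G)
    (hH : LeftReduced H) (gG : Guaranteed G) (gH : Guaranteed H) (h : Equivalent G H)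
    (ih : ∀ C ∈ G.left.opts, ∀ D ∈ H.left.opts, Equivalent C D → C = D)
    (hne : H.left.opts.Nonempty) (hA : A ∈ G.left.opts) : A ∈ H.left.opts := by
  by_cases hrev : ∃ B, LeftReversible G A B
  · obtain ⟨B, hB⟩ := hrev
    obtain ⟨l, n, rfl, hn, hl, hlt, -⟩ := hG.reversible_option gG hB
    obtain ⟨D, hD, e⟩ := exists_underLs_eq gH hne
    by_cases hDrev : ∃ B, LeftReversible H D B
    · obtain ⟨B', hB'⟩ := hDrev
      obtain ⟨l', n', rfl, hn', hl', -⟩ := hH.reversible_option gH hB'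
      obtain rfl : l = l' := by rw [← hl, ← hl', h.underLs_eq]
      have hset : {k : ℕ | Ge G (number l + conj (waiting k))} =
          {k : ℕ | Ge H (number l + conj (waiting k))} :=
        Set.ext fun k => ⟨h.2.trans, h.1.trans⟩
      obtain rfl : n = n' := (hset ▸ hn).unique hn'
      exact hD
    · push Not at hDrev
      have hDG := mem_left_opts_of_not_reversible hH hG gG h.symm
        (fun C hC D hD hCD => (ih D hD C hC hCD.symm).symm) hD hDrev
      refine absurd ?_ (hlt D hDG ?_).ne
      · rw [← e, ← h.underLs_eq, hl]
      · rintro rfl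
        exact hDrev B ⟨hD, hB.2.1, h.2.trans hB.2.2⟩
  · push Not at hrev
    exact mem_left_opts_of_not_reversible hG hH gH h ih hA hrev

theorem left_opts_of_left_eq_atom {G H : ScoringGame} (hG : LeftReduced G)
    (hH : LeftReduced H) (gG : Guaranteed G) (gH : Guaranteed H) (h : Equivalent G H)
    (hne : G.left.opts.Nonempty) {x : ℝ} (hx : H.left = Side.atom x) :
    (∃ n, G.left.opts = {number x + conj (waiting n)}) ∧
      ¬ Guaranteed (mk (Side.atom x) G.right) := by
  have hrev : ∀ A ∈ G.left.opts, ∃ B, LeftReversible G A B := by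
    intro A hA
    by_contra! hcon
    exact Side.not_mem_opts_of_eq_atom hx (mem_left_opts_of_not_reversible hG hH gH h
      (fun _ _ D hD => (Side.not_mem_opts_of_eq_atom hx hD).elim) hA hcon)
  obtain ⟨A, hA⟩ := hne
  obtain ⟨B, hB⟩ := hrev A hA
  obtain ⟨l, n, hAn, -, hl, hlt, hgs⟩ := hG.reversible_option gG hB
  obtain rfl : l = x := by rw [← hl, h.underLs_eq, underLs_of_atom hx]
  have honly : G.left.opts = {A} := by
    refine Set.Subset.antisymm (fun C hC => ?_) (Set.singleton_subset_iff.2 hA)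
    by_contra hCA
    obtain ⟨B', hB'⟩ := hrev C hC
    obtain ⟨l', n', rfl, -, hl', -⟩ := hG.reversible_option gG hB'
    refine (hlt _ hC hCA).ne ?_
    rw [underRs_number_add_conj_waiting, ← hl', hl]
  exact ⟨⟨n + 1, by rw [honly, hAn]⟩, hgs honly⟩

/-- The one way in which the Left sides of equivalent reduced games could differ: `G` has the single
Left option `x - n̂` and `H` the Left atom `∅^x`, which may not replace that option in `G`. -/
def LeftExceptional (G H : ScoringGame) : Prop :=
  ∃ x n, H.left = Side.atom x ∧ G.left.opts = {number x + conj (waiting n)} ∧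
    ¬ Guaranteed (mk (Side.atom x) G.right)

theorem left_eq_or_exceptional {G H : ScoringGame} (hG : LeftReduced G)
    (hH : LeftReduced H) (gG : Guaranteed G) (gH : Guaranteed H) (h : Equivalent G H)
    (ih : ∀ C ∈ G.left.opts, ∀ D ∈ H.left.opts, Equivalent C D → C = D) :
    G.left = H.left ∨ LeftExceptional G H ∨ LeftExceptional H G := by
  rcases G.left.exists_atom_or_nonempty with ⟨x, hx⟩ | hGne <;>
    rcases H.left.exists_atom_or_nonempty with ⟨y, hy⟩ | hHne
  · left
    rw [hx, hy, ← underLs_of_atom hx, ← underLs_of_atom hy, h.underLs_eq]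
  · obtain ⟨⟨n, hn⟩, hgs⟩ := left_opts_of_left_eq_atom hH hG gH gG h.symm hHne hx
    exact Or.inr (Or.inr ⟨x, n, hx, hn, hgs⟩)
  · obtain ⟨⟨n, hn⟩, hgs⟩ := left_opts_of_left_eq_atom hG hH gG gH h hGne hy
    exact Or.inr (Or.inl ⟨y, n, hy, hn, hgs⟩)
  · left
    refine Side.eq_of_opts_eq (Set.Subset.antisymm (fun A hA => ?_) (fun A hA => ?_)) hGne
    · exact mem_left_opts_of_nonempty hG hH gG gH h ih hHne hA
    · exact mem_left_opts_of_nonempty hH hG gH gG h.symm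
        (fun C hC D hD hCD => (ih D hD C hC hCD.symm).symm) hGne hA

/-- If `H` is guaranteed, the Left atom of `H` may replace the Left side of `G`, provided that the
Right side of `G` carries a single score `r` which is an atom in `H`. -/
theorem guaranteed_mk_atom {G H : ScoringGame} (gG : Guaranteed G) (gH : Guaranteed H) {x r : ℝ}
    (hx : H.left = Side.atom x) (hr : IsAtomIn r H)
    (hG : G.right = Side.atom r ∨ ∃ n, G.right.opts = {number r + waiting n}) :
    Guaranteed (mk (Side.atom x) G.right) := by
  have hxr : x ≤ r := gH.left_atom_le hx hr
  have hatoms : ∀ s, IsAtomIn s (mk (Side.atom x) G.right) → s = x ∨ s = r := by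
    intro s hs
    rcases isAtomIn_iff.1 hs with h | h | ⟨O, hO | hO, hs⟩
    · rw [left_mk] at h; injection h with h; exact Or.inl h.symm
    · rw [right_mk] at h
      rcases hG with hG | ⟨n, hG⟩
      · rw [hG] at h; injection h with h; exact Or.inr h.symm
      · have := Side.opts_of_eq_atom h
        rw [hG] at this
        exact (Set.singleton_ne_empty _ this).elim
    · exact (Side.not_mem_opts_of_eq_atom (left_mk _ _) hO).elim
    · rw [right_mk] at hO
      rcases hG with hG | ⟨n, hG⟩
      · exact (Side.not_mem_opts_of_eq_atom hG hO).elim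
      · rw [hG, Set.mem_singleton_iff] at hO
        subst hO
        exact Or.inr (eq_of_isAtomIn_number_add_waiting hs)
  refine guaranteed_iff.2 ⟨?_, fun l hl s hs => ?_, fun t ht s hs => ?_⟩
  · rintro O (hO | hO)
    · exact (Side.not_mem_opts_of_eq_atom (left_mk _ _) hO).elim
    · rw [right_mk] at hO
      exact gG.of_isOption (Or.inr hO)
  · rw [left_mk] at hl
    injection hl with hl
    subst hl
    rcases hatoms s hs with rfl | rfl
    · exact le_rfl
    · exact hxr
  · rw [right_mk] at ht
    rcases hG with hG | ⟨n, hG⟩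
    · rw [hG] at ht
      injection ht with ht
      subst ht
      rcases hatoms s hs with rfl | rfl
      · exact hxr
      · exact le_rfl
    · exact (Side.not_mem_opts_of_eq_atom ht (hG ▸ Set.mem_singleton _)).elim

theorem LeftExceptional.right_ne {G H : ScoringGame} (h : LeftExceptional G H)
    (gH : Guaranteed H) : G.right ≠ H.right := by
  obtain ⟨x, n, hx, -, hgs⟩ := h
  intro e
  rw [e, ← hx, mk_left_right] at hgs
  exact hgs gH

/-- What `LeftExceptional` says on the Right side, conjugation being undone. -/
theorem LeftExceptional.of_conj {G H : ScoringGame} (h : LeftExceptional (conj G) (conj H)) :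
    ∃ r n, H.right = Side.atom r ∧ G.right.opts = {number r + waiting n} := by
  obtain ⟨x, n, hx, hopts, -⟩ := h
  refine ⟨-x, n, left_conj_eq_atom_iff.1 hx, ?_⟩
  have := congrArg (fun S => conj '' S) hopts
  simp only [left_opts_conj, Set.image_image, conj_conj, Set.image_id', Set.image_singleton,
    conj_number_add_conj_waiting] at this
  exact this

/-- The Left and Right sides cannot both differ: all atoms on the Right sides of `G` and `H` are
then equal to one `r`, and `x ≤ r` since `H` is guaranteed. -/
theorem LeftExceptional.false_of_conj {G H : ScoringGame} (h : LeftExceptional G H)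
    (gG : Guaranteed G) (gH : Guaranteed H)
    (h' : LeftExceptional (conj G) (conj H) ∨ LeftExceptional (conj H) (conj G)) : False := by
  obtain ⟨x, n, hx, -, hgs⟩ := h
  rcases h' with h' | h'
  · obtain ⟨r, m, hr, hopts⟩ := h'.of_conj
    exact hgs (guaranteed_mk_atom gG gH hx (isAtomIn_iff.2 (Or.inr (Or.inl hr)))
      (Or.inr ⟨m, hopts⟩))
  · obtain ⟨r, m, hr, hopts⟩ := h'.of_conj
    have hmem : number r + waiting m ∈ H.right.opts := hopts ▸ Set.mem_singleton _
    have hatom : (number r + waiting m).right = Side.atom r := by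
      rw [right_add_eq_atom (right_number r) (right_waiting m), add_zero]
    exact hgs (guaranteed_mk_atom gG gH hx
      (IsAtomIn.of_isOption (isAtomIn_iff.2 (Or.inr (Or.inl hatom))) (Or.inr hmem)) (Or.inl hr))

theorem Equivalent.conj {G H : ScoringGame} (h : Equivalent G H) :
    Equivalent (conj G) (conj H) :=
  ⟨h.2.conj, h.1.conj⟩

end ScoringGame

open ScoringGame in
theorem mainTheorem2 (G H : ScoringGame) (hG : ScoringGame.Guaranteed G)
    (hH : ScoringGame.Guaranteed H) (hGred : ScoringGame.Reduced G)
    (hHred : ScoringGame.Reduced H) (hGH : ScoringGame.Equivalent G H) : G = H := by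
  induction G using ScoringGame.induction generalizing H with
  | h G ih =>
  have hL := left_eq_or_exceptional hGred.leftReduced hHred.leftReduced hG hH hGH
    fun C hC D hD hCD => ih C (Or.inl hC) D (hG.of_isOption (Or.inl hC))
      (hH.of_isOption (Or.inl hD)) (hGred.of_isOption (Or.inl hC))
      (hHred.of_isOption (Or.inl hD)) hCD
  -- The Right sides of `G` and `H` are, up to conjugation, the Left sides of `conj G` and `conj H`.
  have hR := left_eq_or_exceptional hGred.leftReduced_conj hHred.leftReduced_conj hG.conj hH.conj
    hGH.conj (by
      intro C hC D hD hCD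
      rw [left_opts_conj] at hC hD
      obtain ⟨C, hC, rfl⟩ := hC
      obtain ⟨D, hD, rfl⟩ := hD
      have hCD' := hCD.conj
      rw [conj_conj, conj_conj] at hCD'
      rw [ih C (Or.inr hC) D (hG.of_isOption (Or.inr hC)) (hH.of_isOption (Or.inr hD))
        (hGred.of_isOption (Or.inr hC)) (hHred.of_isOption (Or.inr hD)) hCD'])
  have hright : (conj G).left = (conj H).left → G.right = H.right := fun e => by
    rw [← conj_conj G, ← conj_conj H]
    exact right_conj_congr e
  have hleft : G.left = H.left → (conj G).right = (conj H).right := right_conj_congr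
  rcases hL with hL | hL | hL
  · rcases hR with hR | hR | hR
    · exact ext_sides hL (hright hR)
    · exact absurd (hleft hL) (hR.right_ne hH.conj)
    · exact absurd (hleft hL).symm (hR.right_ne hG.conj)
  · rcases hR with hR | hR
    · exact absurd (hright hR) (hL.right_ne hH)
    · exact (hL.false_of_conj hG hH hR).elim
  · rcases hR with hR | hR
    · exact absurd (hright hR).symm (hL.right_ne hG)
    · exact (hL.false_of_conj hH hG hR.symm).elim
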